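/- Let $q$ be a prime power, let $F=\mathbb{F}_q$ or $F=\mathbb{F}_{q^2}$, and put $\bar\lambda=\lambda^q$ for $\lambda\in F$, an automorphism of $F$ of order $1$ or $2$ respectively. Let $V$ be a finite-dimensional $F$-vector space and let $\beta:V\times V\to F$ be a non-degenerate reflexive sesquilinear form, that is, a non-degenerate biadditive map with $\beta(au,bv)=a\bar b\,\beta(u,v)$ and $\beta(u,v)=0\iff\beta(v,u)=0$. Let $\mathscr{C}=\mathscr{C}(\beta)\le \mathrm{GL}(V)$ be its group of isometries. Let $X_1,X_2\in\mathscr{C}$ be semisimple, that is, of order coprime to the characteristic of $F$. Two elements of $\mathrm{GL}(V)$ are called similar if they are conjugate in $\mathrm{GL}(V)$. 1. If $\mathscr{C}$ is a symplectic group ($F=\mathbb{F}_q$ and $\beta$ is alternating, i.e. $\beta(v,v)=0$ for all $v$; $q$ may be even or odd) or a unitary group ($F=\mathbb{F}_{q^2}$ and $\beta$ is hermitian, i.e. $\beta(u,v)=\overline{\beta(v,u)}$ for all $u,v$), then $X_1$ and $X_2$ are conjugate in $\mathscr{C}$ if and only if they are similar. 2. If $\mathscr{C}$ is an orthogonal group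 with $q$ odd ($F=\mathbb{F}_q$ and $\beta$ is symmetric), then $X_1$ and $X_2$ are conjugate in $\mathscr{C}$ if and only if they are similar and, for each $\epsilon\in\{1,-1\}$, the forms induced by $\beta$ on $\ker(X_1-\epsilon)$ and on $\ker(X_2-\epsilon)$ have the same type. Here the type of a non-degenerate symmetric form $\gamma$ on an $F$-space $W$ ($q$ odd) tells which of the two congruence classes in its dimension it belongs to. If $\dim W=2k$ is even, the type is plus or minus according to whether the largest dimension of a subspace on which $\gamma(w,w)$ vanishes identically is $k$ or $k-1$ (the zero space has plus type). If $\dim W$ is odd, the type is the class, square or non-square in $F^*$, of the determinant of a Gram matrix of $\gamma$. -/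

import Mathlib

/-! Forms are linear in the first variable and `σ`-semilinear in the second one. -/

namespace ClassicalForm

section Forms

variable {F : Type*} [Field F] {σ : F →+* F} {V : Type*} [AddCommGroup V] [Module F V]

/-- The group of isometries of the sesquilinear form `β`, as a subgroup of `GL(V)`. -/
def isometryGroup (β : V →ₗ[F] V →ₛₗ[σ] F) : Subgroup (V ≃ₗ[F] V) where
  carrier := {X | ∀ u v, β (X u) (X v) = β u v}
  mul_mem' := by
    intro X Y hX hY u v
    rw [LinearEquiv.mul_apply, LinearEquiv.mul_apply, hX, hY]
  one_mem' := fun _ _ => rfl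
  inv_mem' := by
    intro X hX u v
    have h := hX (X⁻¹ u) (X⁻¹ v)
    rw [← LinearEquiv.mul_apply, ← LinearEquiv.mul_apply, mul_inv_cancel] at h
    exact h.symm

/-- Alternating form: the automorphism is trivial and `β(v,v) = 0` for all `v`. -/
def IsAlternating (β : V →ₗ[F] V →ₛₗ[σ] F) : Prop :=
  (∀ a, σ a = a) ∧ ∀ v, β v v = 0

/-- Symmetric form: the automorphism is trivial and `β(u,v) = β(v,u)`. -/
def IsSymmetric (β : V →ₗ[F] V →ₛₗ[σ] F) : Prop :=
  (∀ a, σ a = a) ∧ ∀ u v, β u v = β v u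

/-- Hermitian form: the automorphism has order two and `β(u,v)` is the conjugate of `β(v,u)`. -/
def IsHermitian (β : V →ₗ[F] V →ₛₗ[σ] F) : Prop :=
  ((∀ a, σ (σ a) = a) ∧ ∃ a, σ a ≠ a) ∧ ∀ u v, β u v = σ (β v u)

/-- An element of `GL(V)`, with `V` finite, is semisimple when its order is coprime to the
characteristic of the field. -/
def IsSemisimpleElement (X : V ≃ₗ[F] V) : Prop :=
  (orderOf X).Coprime (ringChar F)

/-- `k` is the Witt index of `β`: the largest dimension of a totally singular subspace. When
`β` is symmetric in odd characteristic, with quadratic form `Q(v) = β(v,v)/2`, the condition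
`Q(v) = 0` is `β(v,v) = 0`. -/
def HasWittIndex (β : V →ₗ[F] V →ₛₗ[σ] F) (k : ℕ) : Prop :=
  IsGreatest {m | ∃ W : Submodule F V, (∀ w ∈ W, β w w = 0) ∧ Module.finrank F W = m} k

/-- The determinant of the Gram matrix of `β` in the basis `b`. -/
noncomputable def gramDet {n : ℕ} (β : V →ₗ[F] V →ₛₗ[σ] F) (b : Module.Basis (Fin n) F V) : F :=
  (Matrix.of fun i j => β (b i) (b j)).det

/-- The form induced by `β` on the eigenspace of `X` for `a`. -/
noncomputable def eigenspaceForm (β : V →ₗ[F] V →ₛₗ[σ] F) (X : V ≃ₗ[F] V) (a : F) :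
    Module.End.eigenspace (X : Module.End F V) a →ₗ[F]
      Module.End.eigenspace (X : Module.End F V) a →ₛₗ[σ] F :=
  β.domRestrict₁₂ _ _

end Forms

/-- The types of non-degenerate symmetric forms over a finite field of odd characteristic:
two in even dimension and two in odd dimension. -/
inductive FormType
  | plus
  | minus
  | oddSquare
  | oddNonsquare

/-- `HasType β t`: the form `β` has type `t`. In even dimension `2k` the type is plus or minus,
according to whether the Witt index is `k` or `k - 1`; in odd dimension it is the class of the
discriminant modulo squares. -/
def HasType {F : Type*} [Field F] {σ : F →+* F} {V : Type*} [AddCommGroup V] [Module F V]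
    (β : V →ₗ[F] V →ₛₗ[σ] F) : FormType → Prop
  | .plus => ∃ k, Module.finrank F V = 2 * k ∧ HasWittIndex β k
  | .minus => ∃ k, Module.finrank F V = 2 * (k + 1) ∧ HasWittIndex β k
  | .oddSquare => ∃ (k : ℕ) (b : Module.Basis (Fin (2 * k + 1)) F V), IsSquare (gramDet β b)
  | .oddNonsquare => ∃ (k : ℕ) (b : Module.Basis (Fin (2 * k + 1)) F V), ¬ IsSquare (gramDet β b)

/-- Two forms, possibly on different spaces, have the same type. -/
def SameType {F : Type*} [Field F] {σ : F →+* F}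
    {V : Type*} [AddCommGroup V] [Module F V] {W : Type*} [AddCommGroup W] [Module F W]
    (β : V →ₗ[F] V →ₛₗ[σ] F) (γ : W →ₗ[F] W →ₛₗ[σ] F) : Prop :=
  ∃ t : FormType, HasType β t ∧ HasType γ t

end ClassicalForm

/-!
A conjugating element of `GL(V)` makes `V`, with the actions of `X₁` and `X₂`, into two isomorphic
modules over the group algebra `R = F[G]` of a finite cyclic group `G` whose order is invertible in
`F`, so that `R` is semisimple. The form is invariant, hence the adjoint of `r : R` is `τ r`, for
the `σ`-semilinear involution `τ` of `R` that inverts the elements of `G`. It has to be shown that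
the two modules are isometric over `R` (`exists_equivariant_isometry`).

This is done by induction on the size of the module (`isometric_of_sameHomCount`), splitting off
isometric nondegenerate summands (`Isometric.of_orth`). The orthogonal complements remain isomorphic
because isomorphism is measured by the numbers of homomorphisms from finite modules, which are
multiplicative on direct sums (`SameHomCount.cancel`). There are two kinds of summands.

* Suppose that a simple submodule `W` of `V` is not totally isotropic. Then `τ` induces an
  involution of the finite field `R / Ann W`. Assume that this involution is nontrivial. If a copy
  of `W` in the second module `V'` is totally isotropic, a simple submodule that pairs nontrivially
  with it is again isomorphic to `W`. Either this submodule or the graph of a suitable isomorphism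
  between the two is not totally isotropic (`IsHermitianPairing.exists_graph_ne_zero`). Two nonzero
  forms on `W` differ by an element of `R / Ann W` fixed by `τ`, which is a norm `a * τ a`, so that
  scaling by `a` is an isometry (`exists_smul_isometry_of_isSimpleModule`).
* If all simple submodules are totally isotropic, two of them in duality span a hyperbolic summand,
  and all such summands with isomorphic constituents are isometric
  (`Reduces.of_simples_isotropic`).

The remaining case of a trivial involution on `R / Ann W` concerns the vectors `v` with
`τ r • v = r • v` for all `r : R`; when `σ` is trivial, they satisfy `g² v = v` for all `g` in `G`.
If `σ` is nontrivial, only `v = 0` is such a vector. If the form is alternating, `v` is orthogonal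
to the submodule that it generates (`FixedIsotropic`), so that no such `W` exists. For a symmetric
form, they span the sum of the eigenspaces of a generator for `1` and `-1`, which are nondegenerate
and orthogonal and are split off beforehand (`isometric_of_isometric_eigenSubmodules`). They are
isometric when they have the same type (`SameType.isometric`): a form over a finite field of odd
characteristic is determined by its dimension and discriminant, because it represents `1` in
dimension at least two, and in even dimension by its Witt index, because anisotropic planes are
unique up to isometry.
-/

namespace ClassicalForm

/-! ### Pairings, adjoints and hermitian forms -/

section Pairings

variable {F : Type*} [Field F] {R : Type*} [CommRing R]

/-- A pairing of two `R`-modules with values in the field `F`, linear over `F` in the first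
variable, in which the adjoint of `r : R` is `τ r`. The pairing is a bare function, so that it can
be restricted to submodules and pulled back without bundling. -/
structure IsAdjointPairing {A M : Type*} [AddCommGroup A] [Module F A] [Module R A]
    [AddCommGroup M] [Module R M] (τ : R → R) (P : A → M → F) : Prop where
  add_left : ∀ a a' m, P (a + a') m = P a m + P a' m
  add_right : ∀ a m m', P a (m + m') = P a m + P a m'
  smul_left : ∀ (c : F) a m, P (c • a) m = c * P a m
  adj_left : ∀ (r : R) a m, P (r • a) m = P a (τ r • m)
  adj_right : ∀ (r : R) a m, P a (r • m) = P (τ r • a) m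

/-- An adjoint pairing of a module with itself that is hermitian up to the scalar `ε`, for the
automorphism `σ` of the field. -/
structure IsHermitianPairing {V : Type*} [AddCommGroup V] [Module F V] [Module R V]
    (τ : R → R) (σ : F →+* F) (ε : F) (B : V → V → F) : Prop extends IsAdjointPairing τ B where
  symm : ∀ u v, B v u = ε * σ (B u v)

/-- No nonzero element of the first module pairs to zero with the whole second module. -/
def NondegLeft {A M : Type*} [Zero A] (P : A → M → F) : Prop :=
  ∀ a, (∀ m, P a m = 0) → a = 0

/-- No nonzero element of the second module pairs to zero with the whole first module. -/
def NondegRight {A M : Type*} [Zero M] (P : A → M → F) : Prop :=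
  ∀ m, (∀ a, P a m = 0) → m = 0

/-- Restriction of a form to a submodule. -/
def restrictForm {V : Type*} [AddCommGroup V] [Module R V] (B : V → V → F)
    (W : Submodule R V) : W → W → F :=
  fun u v => B u v

/-- There is an `R`-linear isomorphism carrying one form to the other. -/
def Isometric {F : Type*} (R : Type*) [CommRing R] {V V' : Type*} [AddCommGroup V] [Module R V]
    [AddCommGroup V'] [Module R V'] (B : V → V → F) (B' : V' → V' → F) : Prop :=
  ∃ e : V ≃ₗ[R] V', ∀ u v, B' (e u) (e v) = B u v

theorem Isometric.symm {F : Type*} {V V' : Type*} [AddCommGroup V] [Module R V]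
    [AddCommGroup V'] [Module R V'] {B : V → V → F} {B' : V' → V' → F}
    (h : Isometric R B B') : Isometric R B' B := by
  obtain ⟨e, he⟩ := h
  exact ⟨e.symm, fun u v => by rw [← he]; simp⟩

section

variable {A M : Type*} [AddCommGroup A] [Module F A] [Module R A]
    [AddCommGroup M] [Module R M] {τ : R → R} {P : A → M → F}

theorem IsAdjointPairing.zero_left (h : IsAdjointPairing τ P) (m : M) : P 0 m = 0 := by
  simpa using h.add_left 0 0 m

theorem IsAdjointPairing.zero_right (h : IsAdjointPairing τ P) (a : A) : P a 0 = 0 := by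
  simpa using h.add_right a 0 0

theorem IsAdjointPairing.neg_left (h : IsAdjointPairing τ P) (a : A) (m : M) :
    P (-a) m = -P a m := by
  have := h.add_left (-a) a m
  rw [neg_add_cancel, h.zero_left] at this
  linear_combination -this

theorem IsAdjointPairing.neg_right (h : IsAdjointPairing τ P) (a : A) (m : M) :
    P a (-m) = -P a m := by
  have := h.add_right a (-m) m
  rw [neg_add_cancel, h.zero_right] at this
  linear_combination -this

theorem IsAdjointPairing.sub_left (h : IsAdjointPairing τ P) (a a' : A) (m : M) :
    P (a - a') m = P a m - P a' m := by
  rw [sub_eq_add_neg, h.add_left, h.neg_left, sub_eq_add_neg]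

theorem IsAdjointPairing.sub_right (h : IsAdjointPairing τ P) (a : A) (m m' : M) :
    P a (m - m') = P a m - P a m' := by
  rw [sub_eq_add_neg, h.add_right, h.neg_right, sub_eq_add_neg]

/-- A nonzero pairing with a simple module on the left is nondegenerate on the left. -/
theorem IsAdjointPairing.nondegLeft_of_isSimpleModule [IsSimpleModule R A]
    (h : IsAdjointPairing τ P) (hne : ∃ a m, P a m ≠ 0) : NondegLeft P := by
  let K : Submodule R A :=
    { carrier := {a | ∀ m, P a m = 0}
      add_mem' := fun {a b} ha hb m => by rw [h.add_left, ha, hb, add_zero]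
      zero_mem' := h.zero_left
      smul_mem' := fun r a ha m => by rw [h.adj_left]; exact ha _ }
  obtain ⟨a, m, ham⟩ := hne
  rcases eq_bot_or_eq_top K with hK | hK
  · intro b hb
    have : b ∈ K := hb
    rwa [hK, Submodule.mem_bot] at this
  · have : a ∈ K := hK ▸ Submodule.mem_top
    exact absurd (this m) ham

/-- A nonzero pairing with a simple module on the right is nondegenerate on the right. -/
theorem IsAdjointPairing.nondegRight_of_isSimpleModule [IsSimpleModule R M]
    (h : IsAdjointPairing τ P) (hne : ∃ a m, P a m ≠ 0) : NondegRight P := by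
  let K : Submodule R M :=
    { carrier := {m | ∀ a, P a m = 0}
      add_mem' := fun {a b} ha hb m => by rw [h.add_right, ha, hb, add_zero]
      zero_mem' := h.zero_right
      smul_mem' := fun r a ha m => by rw [h.adj_right]; exact ha _ }
  obtain ⟨a, m, ham⟩ := hne
  rcases eq_bot_or_eq_top K with hK | hK
  · intro b hb
    have : b ∈ K := hb
    rwa [hK, Submodule.mem_bot] at this
  · have : m ∈ K := hK ▸ Submodule.mem_top
    exact absurd (this a) ham

/-- Every functional on the first module of a pairing that is nondegenerate on the left is
represented by an element of the second module. -/
theorem IsAdjointPairing.exists_represents [Algebra F R] [IsScalarTower F R A]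
    [FiniteDimensional F A] (h : IsAdjointPairing τ P) (hP : NondegLeft P) (f : A →ₗ[F] F) :
    ∃ m, ∀ a, P a m = f a := by
  let Φ : M → Module.Dual F A := fun m =>
    { toFun := fun a => P a m
      map_add' := fun a b => h.add_left a b m
      map_smul' := fun c a => h.smul_left c a m }
  let S : Submodule F (Module.Dual F A) :=
    { carrier := Set.range Φ
      add_mem' := by
        rintro _ _ ⟨m, rfl⟩ ⟨m', rfl⟩
        exact ⟨m + m', LinearMap.ext fun a => h.add_right a m m'⟩
      zero_mem' := ⟨0, LinearMap.ext fun a => h.zero_right a⟩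
      smul_mem' := by
        rintro c _ ⟨m, rfl⟩
        refine ⟨τ (algebraMap F R c) • m, LinearMap.ext fun a => ?_⟩
        change P a (τ (algebraMap F R c) • m) = c * P a m
        rw [← h.adj_left, algebraMap_smul, h.smul_left] }
  -- The functionals coming from the second module separate the points of the first one.
  have hS : S.dualCoannihilator = ⊥ := by
    rw [eq_bot_iff]
    intro a ha
    rw [Submodule.mem_dualCoannihilator] at ha
    exact hP a fun m => ha (Φ m) ⟨m, rfl⟩
  have hfin := Subspace.finrank_add_finrank_dualCoannihilator_eq S
  rw [hS, finrank_bot, add_zero, ← Subspace.dual_finrank_eq] at hfin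
  have hf : f ∈ S := by
    rw [Submodule.eq_top_of_finrank_eq hfin]
    exact Submodule.mem_top
  obtain ⟨m, hm⟩ := hf
  exact ⟨m, fun a => LinearMap.congr_fun hm a⟩

/-- A pairing of `A` with `N` factors through any nondegenerate pairing of `A` with `M`. -/
theorem IsAdjointPairing.exists_factor [Algebra F R] [IsScalarTower F R A] [FiniteDimensional F A]
    {N : Type*} [AddCommGroup N] [Module R N] {Q : A → N → F}
    (h : IsAdjointPairing τ P) (hl : NondegLeft P) (hr : NondegRight P)
    (hQ : IsAdjointPairing τ Q) : ∃ T : N →ₗ[R] M, ∀ a n, P a (T n) = Q a n := by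
  have hex : ∀ n, ∃ m, ∀ a, P a m = Q a n := fun n =>
    h.exists_represents hl
      { toFun := fun a => Q a n
        map_add' := fun a b => hQ.add_left a b n
        map_smul' := fun c a => hQ.smul_left c a n }
  choose T hT using hex
  have huniq : ∀ m m', (∀ a, P a m = P a m') → m = m' := fun m m' hm =>
    sub_eq_zero.mp (hr _ fun a => by rw [h.sub_right, hm, sub_self])
  refine ⟨{ toFun := T, map_add' := fun n n' => huniq _ _ fun a => ?_,
            map_smul' := fun r n => huniq _ _ fun a => ?_ }, fun a n => hT n a⟩
  · rw [h.add_right, hT, hT, hT, hQ.add_right]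
  · rw [RingHom.id_apply, h.adj_right, hT, hT, hQ.adj_right]

end

/-- Linear maps pull adjoint pairings back to adjoint pairings. -/
theorem IsAdjointPairing.comp [Algebra F R] {A M A' M' : Type*} [AddCommGroup A] [Module F A]
    [Module R A] [IsScalarTower F R A] [AddCommGroup M] [Module R M] [AddCommGroup A'] [Module F A']
    [Module R A'] [IsScalarTower F R A'] [AddCommGroup M'] [Module R M'] {τ : R → R}
    {P : A → M → F} (h : IsAdjointPairing τ P) (f : A' →ₗ[R] A) (g : M' →ₗ[R] M) :
    IsAdjointPairing τ fun a m => P (f a) (g m) where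
  add_left a a' m := by rw [map_add, h.add_left]
  add_right a m m' := by rw [map_add, h.add_right]
  smul_left c a m := by rw [← h.smul_left, ← algebraMap_smul R c a, map_smul, algebraMap_smul]
  adj_left r a m := by rw [map_smul, map_smul, h.adj_left]
  adj_right r a m := by rw [map_smul, map_smul, h.adj_right]

section

variable {V : Type*} [AddCommGroup V] [Module F V] [Module R V]
  {τ : R → R} {σ : F →+* F} {ε : F} {B : V → V → F}

theorem IsHermitianPairing.eq_zero_comm (h : IsHermitianPairing τ σ ε B) {u v : V}
    (huv : B u v = 0) : B v u = 0 := by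
  rw [h.symm, huv, map_zero, mul_zero]

theorem IsHermitianPairing.nondegLeft (h : IsHermitianPairing τ σ ε B) (hB : NondegRight B) :
    NondegLeft B :=
  fun a ha => hB a fun m => h.eq_zero_comm (ha m)

/-- The orthogonal complement of a submodule. -/
def IsHermitianPairing.orth (h : IsHermitianPairing τ σ ε B) (W : Submodule R V) :
    Submodule R V where
  carrier := {v | ∀ w ∈ W, B w v = 0}
  add_mem' := fun {a b} ha hb w hw => by rw [h.add_right, ha w hw, hb w hw, add_zero]
  zero_mem' := fun w _ => h.zero_right w
  smul_mem' := fun r a ha w hw => by rw [h.adj_right]; exact ha _ (W.smul_mem _ hw)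

theorem IsHermitianPairing.mem_orth (h : IsHermitianPairing τ σ ε B) {W : Submodule R V} {v : V} :
    v ∈ h.orth W ↔ ∀ w ∈ W, B w v = 0 := Iff.rfl

theorem IsHermitianPairing.mem_orth_range (h : IsHermitianPairing τ σ ε B) {N : Type*}
    [AddCommGroup N] [Module R N] {j : N →ₗ[R] V} {v : V} :
    v ∈ h.orth (LinearMap.range j) ↔ ∀ n, B (j n) v = 0 := by
  simp [h.mem_orth]

variable [Algebra F R] [IsScalarTower F R V]

theorem IsHermitianPairing.comp {N : Type*} [AddCommGroup N] [Module F N] [Module R N]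
    [IsScalarTower F R N] (h : IsHermitianPairing τ σ ε B) (f : N →ₗ[R] V) :
    IsHermitianPairing τ σ ε fun a b => B (f a) (f b) where
  toIsAdjointPairing := h.toIsAdjointPairing.comp f f
  symm _ _ := h.symm _ _

theorem IsHermitianPairing.restrict (h : IsHermitianPairing τ σ ε B) (W : Submodule R V) :
    IsHermitianPairing τ σ ε (restrictForm B W) :=
  h.comp W.subtype

end

end Pairings

/-! ### Splitting off an embedded nondegenerate module -/

section Splitting

variable {F : Type*} [Field F] {R : Type*} [CommRing R] [Algebra F R] {τ : R → R} {σ : F →+* F}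
  {ε : F} {V : Type*} [AddCommGroup V] [Module F V] [Module R V] [IsScalarTower F R V]
  {B : V → V → F} {N : Type*} [AddCommGroup N] [Module F N] [Module R N] [IsScalarTower F R N]
  [FiniteDimensional F N]

/-- A nondegenerate module embedded in `V` is an orthogonal summand. -/
theorem IsHermitianPairing.bijective_coprod (h : IsHermitianPairing τ σ ε B) (j : N →ₗ[R] V)
    (hj : NondegRight fun a b => B (j a) (j b)) :
    Function.Bijective (j.coprod (h.orth (LinearMap.range j)).subtype) := by
  have hN := h.comp j
  constructor
  · rw [← LinearMap.ker_eq_bot, LinearMap.ker_eq_bot']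
    rintro ⟨a, z⟩ haz
    have haz' : j a + (z : V) = 0 := by simpa using haz
    have ha : a = 0 := hj a fun b => by
      have h1 : B (j b) (j a + z) = 0 := by rw [haz', h.zero_right]
      rwa [h.add_right, h.mem_orth_range.mp z.2 b, add_zero] at h1
    have hz : (z : V) = 0 := by simpa [ha] using haz'
    simp [ha, Subtype.ext_iff, hz]
  · intro v
    obtain ⟨T, hT⟩ := hN.toIsAdjointPairing.exists_factor (hN.nondegLeft hj) hj
      (h.toIsAdjointPairing.comp j LinearMap.id)
    refine ⟨(T v, ⟨v - j (T v), h.mem_orth_range.mpr fun n => ?_⟩), by simp⟩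
    rw [h.sub_right, hT, LinearMap.id_apply, sub_self]

/-- The orthogonal decomposition of `V` defined by a nondegenerate module embedded in it. -/
noncomputable def IsHermitianPairing.splitEquiv (h : IsHermitianPairing τ σ ε B) (j : N →ₗ[R] V)
    (hj : NondegRight fun a b => B (j a) (j b)) :
    (N × h.orth (LinearMap.range j)) ≃ₗ[R] V :=
  LinearEquiv.ofBijective _ (h.bijective_coprod j hj)

theorem IsHermitianPairing.splitEquiv_apply (h : IsHermitianPairing τ σ ε B) (j : N →ₗ[R] V)
    (hj : NondegRight fun a b => B (j a) (j b)) (p : N × h.orth (LinearMap.range j)) :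
    h.splitEquiv j hj p = j p.1 + p.2 := by
  simp [splitEquiv]

theorem IsHermitianPairing.apply_splitEquiv (h : IsHermitianPairing τ σ ε B) (j : N →ₗ[R] V)
    (hj : NondegRight fun a b => B (j a) (j b)) (p p' : N × h.orth (LinearMap.range j)) :
    B (h.splitEquiv j hj p) (h.splitEquiv j hj p') = B (j p.1) (j p'.1) + B p.2 p'.2 := by
  have h1 := h.mem_orth_range.mp p'.2.2 p.1
  have h2 := h.eq_zero_comm (h.mem_orth_range.mp p.2.2 p'.1)
  rw [splitEquiv_apply, splitEquiv_apply, h.add_left, h.add_right, h.add_right, h1, h2]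
  ring

theorem IsHermitianPairing.nondegRight_orth (h : IsHermitianPairing τ σ ε B) (hB : NondegRight B)
    (j : N →ₗ[R] V) (hj : NondegRight fun a b => B (j a) (j b)) :
    NondegRight (restrictForm B (h.orth (LinearMap.range j))) := by
  intro z hz
  refine Subtype.ext (hB z fun v => ?_)
  obtain ⟨p, rfl⟩ := (h.splitEquiv j hj).surjective v
  rw [splitEquiv_apply, h.add_left, h.mem_orth_range.mp z.2, zero_add]
  exact hz p.2

variable {V' : Type*} [AddCommGroup V'] [Module F V'] [Module R V'] [IsScalarTower F R V']
  {B' : V' → V' → F}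

/-- Isometric embeddings of a nondegenerate module with isometric orthogonal complements extend
to an isometry of the ambient modules. -/
theorem Isometric.of_orth (h : IsHermitianPairing τ σ ε B) (h' : IsHermitianPairing τ σ ε B')
    (j : N →ₗ[R] V) (j' : N →ₗ[R] V') (hj : NondegRight fun a b => B (j a) (j b))
    (hjj' : ∀ a b, B' (j' a) (j' b) = B (j a) (j b))
    (hiso : Isometric R (restrictForm B (h.orth (LinearMap.range j)))
      (restrictForm B' (h'.orth (LinearMap.range j')))) :
    Isometric R B B' := by
  have hj' : NondegRight fun a b => B' (j' a) (j' b) := by simpa only [hjj'] using hj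
  obtain ⟨e, he⟩ := hiso
  refine ⟨(h.splitEquiv j hj).symm ≪≫ₗ (LinearEquiv.refl R N).prodCongr e ≪≫ₗ
    h'.splitEquiv j' hj', fun u v => ?_⟩
  obtain ⟨p, rfl⟩ := (h.splitEquiv j hj).surjective u
  obtain ⟨p', rfl⟩ := (h.splitEquiv j hj).surjective v
  simp only [LinearEquiv.trans_apply, LinearEquiv.symm_apply_apply, h'.apply_splitEquiv,
    h.apply_splitEquiv]
  have := he p.2 p'.2
  simp only [restrictForm] at this
  simp [hjj', this]

end Splitting

/-! ### Norms in finite fields -/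

/-- In a finite field with a nontrivial involution, every fixed element is a norm. By Hilbert's
Theorem 90 the elements of norm one are the quotients `b / τ b`, and comparing orders shows that
the norms exhaust the fixed elements. -/
theorem exists_mul_map_eq_of_map_eq {E : Type*} [Field E] [Finite E] {τ : E →+* E}
    (hτ : Function.Involutive τ) (hne : ∃ x, τ x ≠ x) {c : E} (hc : τ c = c) :
    ∃ a, a * τ a = c := by
  rcases eq_or_ne c 0 with rfl | hc0
  · exact ⟨0, zero_mul _⟩
  let t : Eˣ →* Eˣ := Units.map (τ : E →* E)
  have ht : ∀ x : Eˣ, ((t x : Eˣ) : E) = τ x := fun x => rfl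
  -- `N` is the norm and `D` is the map of Hilbert's Theorem 90.
  let N : Eˣ →* Eˣ := MonoidHom.id Eˣ * t
  let D : Eˣ →* Eˣ := MonoidHom.id Eˣ / t
  have hN : ∀ x, N x = x * t x := fun x => rfl
  have hD : ∀ x, D x = x / t x := fun x => rfl
  have hker : N.ker ≤ D.range := by
    intro a ha
    have ha' : (a : E) * τ a = 1 := by
      have := congrArg Units.val (MonoidHom.mem_ker.mp ha)
      simpa [hN, ht] using this
    -- Since `a * τ a = 1`, any nonzero `b = x + a * τ x` satisfies `a * τ b = b`.
    have hx : ∃ x : E, x + a * τ x ≠ 0 := by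
      by_contra! hall
      have ha1 : (a : E) = -1 := by
        have := hall 1
        rw [map_one, mul_one] at this
        linear_combination this
      obtain ⟨x, hx⟩ := hne
      have := hall x
      rw [ha1] at this
      exact hx (by linear_combination -this)
    obtain ⟨x, hx⟩ := hx
    refine ⟨Units.mk0 _ hx, ?_⟩
    rw [hD, div_eq_iff_eq_mul]
    ext
    rw [Units.val_mul, ht, Units.val_mk0, map_add, map_mul, hτ x]
    linear_combination -x * ha'
  have hrange : N.range ≤ D.ker := by
    rintro _ ⟨x, rfl⟩
    rw [MonoidHom.mem_ker, hD, div_eq_one]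
    ext
    rw [ht, hN, Units.val_mul, ht, map_mul, hτ, mul_comm]
  have hcard : Nat.card D.ker ≤ Nat.card N.range := by
    have h1 := N.ker.card_mul_index
    have h2 := D.ker.card_mul_index
    rw [Subgroup.index_ker] at h1 h2
    have h3 : Nat.card N.ker ≤ Nat.card D.range := Subgroup.card_le_of_le hker
    have h4 : 0 < Nat.card D.range := Nat.card_pos
    by_contra! hlt
    have h5 : Nat.card N.ker * Nat.card N.range < Nat.card D.ker * Nat.card D.range := by
      calc Nat.card N.ker * Nat.card N.range
          ≤ Nat.card D.range * Nat.card N.range := Nat.mul_le_mul_right _ h3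
        _ < Nat.card D.range * Nat.card D.ker := Nat.mul_lt_mul_of_pos_left hlt h4
        _ = _ := mul_comm _ _
    omega
  have heq : N.range = D.ker := Subgroup.eq_of_le_of_card_ge hrange hcard
  have hmem : Units.mk0 c hc0 ∈ N.range := by
    rw [heq, MonoidHom.mem_ker, hD, div_eq_one]
    ext
    rw [ht, Units.val_mk0, hc]
  obtain ⟨a, ha⟩ := hmem
  exact ⟨a, by simpa [hN, ht] using congrArg Units.val ha⟩

/-! ### Forms on simple modules -/

section Simple

variable {F : Type*} [Field F] {R : Type*} [CommRing R] [Algebra F R] {τ : R →+* R} {σ : F →+* F}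
  {ε : F}

/-- On a simple module on which the adjoint involution is nontrivial, every hermitian pairing is
obtained from a given nonzero one by multiplying the variables by some `a : R`. The two pairings
differ by a scalar of the finite field `R / Ann W` that is fixed by the involution, and such a
scalar is a norm. -/
theorem exists_smul_isometry_of_isSimpleModule {W : Type*} [AddCommGroup W] [Module F W]
    [Module R W] [IsScalarTower F R W] [Finite W] [FiniteDimensional F W] [IsSimpleModule R W]
    {B B₂ : W → W → F} (h : IsHermitianPairing τ σ ε B) (h₂ : IsHermitianPairing τ σ ε B₂)
    (hB₂ : ∃ u v, B₂ u v ≠ 0) (hτ : Function.Involutive τ)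
    (hne : ∃ (r : R) (w : W), τ r • w ≠ r • w) :
    ∃ a : R, ∀ u v, B₂ (a • u) (a • v) = B u v := by
  have hr₂ := h₂.nondegRight_of_isSimpleModule hB₂
  obtain ⟨T, hT⟩ := h₂.exists_factor (h₂.nondegLeft_of_isSimpleModule hB₂) hr₂
    h.toIsAdjointPairing
  have hne' := hne
  obtain ⟨_, w₀, hw⟩ := hne'
  have hw₀ : w₀ ≠ 0 := by
    rintro rfl
    simp at hw
  obtain ⟨c, hc⟩ := IsSimpleModule.toSpanSingleton_surjective R hw₀ (T w₀)
  rw [LinearMap.toSpanSingleton_apply] at hc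
  have hTc : ∀ v, T v = c • v := by
    intro v
    obtain ⟨r, rfl⟩ := IsSimpleModule.toSpanSingleton_surjective R hw₀ v
    rw [LinearMap.toSpanSingleton_apply, map_smul, ← hc, smul_comm]
  have hBc : ∀ u v, B u v = B₂ u (c • v) := fun u v => by rw [← hTc, hT]
  have hinj : ∀ x y : W, (∀ u, B₂ u x = B₂ u y) → x = y := fun x y hxy =>
    sub_eq_zero.mp (hr₂ _ fun u => by rw [h₂.sub_right, hxy, sub_self])
  have hτc : ∀ v : W, τ c • v = c • v := fun v => hinj _ _ fun u => by
    rw [← hBc, ← h₂.adj_left, h₂.symm, ← hBc, ← h.symm]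
  let I := Module.annihilator R W
  have hI : ∀ r : R, r ∈ I ↔ ∀ w : W, r • w = 0 := fun r => Module.mem_annihilator
  have hmax : I.IsMaximal := IsSimpleModule.annihilator_isMaximal
  have hIτ : I ≤ I.comap τ := by
    intro r hr
    rw [Ideal.mem_comap, hI]
    intro w
    refine hinj _ _ fun u => ?_
    rw [← h₂.adj_left, (hI r).mp hr, h₂.zero_left, h₂.zero_right]
  let : Field (R ⧸ I) := Ideal.Quotient.field I
  have hmk : ∀ r s : R, Ideal.Quotient.mk I r = Ideal.Quotient.mk I s ↔ ∀ w : W, r • w = s • w := by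
    intro r s
    rw [Ideal.Quotient.eq, hI]
    simp only [sub_smul, sub_eq_zero]
  have : Finite (R ⧸ I) := by
    refine Finite.of_injective (β := W → W)
      (fun x w => (Ideal.Quotient.mk_surjective x).choose • w) fun x y hxy => ?_
    rw [← (Ideal.Quotient.mk_surjective x).choose_spec,
      ← (Ideal.Quotient.mk_surjective y).choose_spec, hmk]
    exact fun w => congrFun hxy w
  let t : R ⧸ I →+* R ⧸ I := Ideal.quotientMap I τ hIτ
  have ht : ∀ r, t (Ideal.Quotient.mk I r) = Ideal.Quotient.mk I (τ r) := fun r =>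
    Ideal.quotientMap_mk
  obtain ⟨x, hx⟩ := exists_mul_map_eq_of_map_eq (τ := t) (c := Ideal.Quotient.mk I c)
    (fun x => by
      obtain ⟨r, rfl⟩ := Ideal.Quotient.mk_surjective x
      rw [ht, ht, hτ])
    (by
      obtain ⟨r, w, hrw⟩ := hne
      refine ⟨Ideal.Quotient.mk I r, fun heq => hrw ?_⟩
      rw [ht] at heq
      exact (hmk _ _).mp heq w)
    (by rw [ht, hmk]; exact hτc)
  obtain ⟨a, rfl⟩ := Ideal.Quotient.mk_surjective x
  rw [ht, ← map_mul, hmk] at hx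
  exact ⟨a, fun u v => by rw [h₂.adj_left, smul_smul, mul_comm, hx, hBc]⟩

end Simple

/-! ### Counting homomorphisms -/

section HomCount

universe u

/-- Every finite module has as many homomorphisms to `V` as to `V'`. For finite semisimple modules
this expresses that `V` and `V'` are isomorphic, in a form that makes the cancellation of direct
summands immediate. -/
def SameHomCount (R : Type*) [CommRing R] (V V' : Type u) [AddCommGroup V] [Module R V]
    [AddCommGroup V'] [Module R V'] : Prop :=
  ∀ (M : Type u) [AddCommGroup M] [Module R M] [Finite M],
    Nat.card (M →ₗ[R] V) = Nat.card (M →ₗ[R] V')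

variable {R : Type*} [CommRing R] {V V' : Type u} [AddCommGroup V] [Module R V]
    [AddCommGroup V'] [Module R V']

theorem SameHomCount.symm (h : SameHomCount R V V') : SameHomCount R V' V :=
  fun M _ _ _ => (h M).symm

theorem SameHomCount.of_equiv (e : V ≃ₗ[R] V') : SameHomCount R V V' :=
  fun M _ _ _ => Nat.card_congr (LinearEquiv.congrRight (M := M) e).toEquiv

theorem natCard_hom_prod (M N Y : Type*) [AddCommGroup M] [Module R M] [AddCommGroup N]
    [Module R N] [AddCommGroup Y] [Module R Y] :
    Nat.card (M →ₗ[R] N × Y) = Nat.card (M →ₗ[R] N) * Nat.card (M →ₗ[R] Y) := by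
  rw [← Nat.card_prod]
  exact Nat.card_congr (LinearMap.prodEquiv R).toEquiv.symm

theorem SameHomCount.cancel {N : Type*} [AddCommGroup N] [Module R N] [Finite N]
    {Y Y' : Type u} [AddCommGroup Y] [Module R Y] [AddCommGroup Y'] [Module R Y']
    (h : SameHomCount R V V') (e : (N × Y) ≃ₗ[R] V) (e' : (N × Y') ≃ₗ[R] V') :
    SameHomCount R Y Y' := by
  intro M _ _ _
  have h1 := h M
  rw [← Nat.card_congr (LinearEquiv.congrRight (M := M) e).toEquiv,
    ← Nat.card_congr (LinearEquiv.congrRight (M := M) e').toEquiv, natCard_hom_prod,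
    natCard_hom_prod] at h1
  have : Finite (M →ₗ[R] N) := Finite.of_injective _ DFunLike.coe_injective
  exact Nat.eq_of_mul_eq_mul_left Nat.card_pos h1

/-- A simple submodule of `V` embeds in `V'`. -/
theorem SameHomCount.exists_injective (h : SameHomCount R V V') (W : Submodule R V) [Finite W]
    [IsSimpleModule R W] : ∃ θ : W →ₗ[R] V', Function.Injective θ := by
  by_contra! hall
  have hzero : ∀ θ : W →ₗ[R] V', θ = 0 := fun θ =>
    (LinearMap.injective_or_eq_zero θ).resolve_left (hall θ)
  have h1 : Nat.card (W →ₗ[R] V') = 1 :=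
    Nat.card_eq_one_iff_unique.mpr ⟨⟨fun a b => by rw [hzero a, hzero b]⟩, ⟨0⟩⟩
  rw [← h W, Nat.card_eq_one_iff_unique] at h1
  have h2 : W.subtype = 0 := h1.1.elim _ _
  have := IsSimpleModule.nontrivial R W
  obtain ⟨w, hw⟩ := exists_ne (0 : W)
  exact hw (Subtype.ext (LinearMap.congr_fun h2 w))

end HomCount

/-! ### Isometry of semisimple modules with hermitian pairings -/

section Main

universe u

theorem exists_isSimpleModule_not_le {R V : Type*} [CommRing R] [AddCommGroup V] [Module R V]
    [IsSemisimpleModule R V] {K : Submodule R V} (hK : K ≠ ⊤) :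
    ∃ U : Submodule R V, IsSimpleModule R U ∧ ¬ U ≤ K := by
  by_contra! hall
  refine hK (eq_top_iff.mpr ?_)
  rw [← IsSemisimpleModule.sSup_simples_eq_top R V]
  exact sSup_le hall

variable {F : Type*} [Field F] {R : Type*} [CommRing R] {τ : R →+* R} {σ : F →+* F} {ε : F}
  {V V' : Type u} [AddCommGroup V] [Module R V] [AddCommGroup V'] [Module R V']
  {B : V → V → F} {B' : V' → V' → F}

/-- Each vector `v` on which the adjoint involution is trivial is orthogonal to the submodule that
it generates. This excludes the simple modules on which nonzero hermitian pairings need not be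
equivalent. -/
def FixedIsotropic (τ : R → R) (B : V → V → F) : Prop :=
  ∀ v, (∀ r, τ r • v = r • v) → ∀ r : R, B (r • v) v = 0

theorem FixedIsotropic.restrict (h : FixedIsotropic τ B) (W : Submodule R V) :
    FixedIsotropic τ (restrictForm B W) :=
  fun v hv r => h v (fun s => congrArg Subtype.val (hv s)) r

/-- The isometry problem for `V` and `V'` reduces to proper nondegenerate submodules. -/
def Reduces (R : Type*) [CommRing R] {V V' : Type u} [AddCommGroup V] [Module R V]
    [AddCommGroup V'] [Module R V'] (B : V → V → F) (B' : V' → V' → F) : Prop :=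
  ∃ (Y : Submodule R V) (Y' : Submodule R V'), Y ≠ ⊤ ∧ Y' ≠ ⊤ ∧
    NondegRight (restrictForm B Y) ∧ NondegRight (restrictForm B' Y') ∧
    (SameHomCount R V V' → SameHomCount R Y Y') ∧
    (Isometric R (restrictForm B Y) (restrictForm B' Y') → Isometric R B B')

theorem Reduces.symm (h : Reduces R B B') : Reduces R B' B := by
  obtain ⟨Y, Y', h1, h2, h3, h4, h5, h6⟩ := h
  exact ⟨Y', Y, h2, h1, h4, h3, fun h => (h5 h.symm).symm, fun h => (h6 h.symm).symm⟩

variable [Module F V] [Module F V']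

theorem IsHermitianPairing.orth_range_ne_top {N : Type*} [AddCommGroup N] [Module R N]
    [Nontrivial N] (h : IsHermitianPairing τ σ ε B)
    (j : N →ₗ[R] V) (hj : NondegRight fun a b => B (j a) (j b)) :
    h.orth (LinearMap.range j) ≠ ⊤ := by
  intro htop
  obtain ⟨a, ha⟩ := exists_ne (0 : N)
  refine ha (hj a fun b => ?_)
  have : j a ∈ h.orth (LinearMap.range j) := htop ▸ Submodule.mem_top
  exact h.mem_orth_range.mp this b

theorem IsHermitianPairing.exists_simple_pairing [IsSemisimpleModule R V] {W : Type*}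
    [AddCommGroup W] [Module R W] (h : IsHermitianPairing τ σ ε B) (hB : NondegRight B)
    (f : W →ₗ[R] V) {w : W} (hw : f w ≠ 0) :
    ∃ U : Submodule R V, IsSimpleModule R U ∧ ∃ (w : W) (u : U), B (f w) u ≠ 0 := by
  have hK : h.orth (LinearMap.range f) ≠ ⊤ := by
    intro htop
    refine hw (h.nondegLeft hB _ fun v => ?_)
    have : v ∈ h.orth (LinearMap.range f) := htop ▸ Submodule.mem_top
    exact h.mem_orth_range.mp this w
  obtain ⟨U, hU, hle⟩ := exists_isSimpleModule_not_le hK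
  refine ⟨U, hU, ?_⟩
  by_contra! hall
  exact hle fun u hu => h.mem_orth_range.mpr fun w => hall w ⟨u, hu⟩

variable [Algebra F R] [IsScalarTower F R V] [IsScalarTower F R V']

/-- If `θ` and `ψ` have totally isotropic images that are not orthogonal, and the adjoint
involution is nontrivial on the simple module `W`, then some graph `θ + a ψ` has an image that is
not totally isotropic. -/
theorem IsHermitianPairing.exists_graph_ne_zero {W : Type*} [AddCommGroup W] [Module F W]
    [Module R W] [IsScalarTower F R W] [IsSimpleModule R W] (h : IsHermitianPairing τ σ ε B)
    (hne : ∃ (r : R) (w : W), τ r • w ≠ r • w) (θ ψ : W →ₗ[R] V)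
    (hθ : ∀ u v, B (θ u) (θ v) = 0) (hψ : ∀ u v, B (ψ u) (ψ v) = 0)
    (hθψ : ∃ u v, B (θ u) (ψ v) ≠ 0) :
    ∃ a : R, ∃ u v, B ((θ + a • ψ) u) ((θ + a • ψ) v) ≠ 0 := by
  have hP : IsAdjointPairing τ fun u v => B (θ u) (ψ v) := h.toIsAdjointPairing.comp θ ψ
  have hl := hP.nondegLeft_of_isSimpleModule hθψ
  by_contra! hall
  have key : ∀ (a : R) (u v : W), B (θ (τ a • u)) (ψ v) + B (ψ (a • u)) (θ v) = 0 := by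
    intro a u v
    have := hall a u v
    simp only [LinearMap.add_apply, LinearMap.smul_apply, h.add_left, h.add_right, hθ,
      ← map_smul ψ, hψ] at this
    rw [map_smul ψ a v, h.adj_right, ← map_smul] at this
    linear_combination this
  obtain ⟨r, w, hrw⟩ := hne
  refine hrw (sub_eq_zero.mp (hl _ fun v => ?_))
  have h1 := key r w v
  have h2 := key 1 (r • w) v
  rw [map_one, one_smul] at h2
  change B (θ (τ r • w - r • w)) (ψ v) = 0
  rw [map_sub, h.sub_left]
  linear_combination h1 - h2

theorem Reduces.of_embeddings [Finite F] {N : Type*} [AddCommGroup N] [Module F N] [Module R N]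
    [IsScalarTower F R N] [FiniteDimensional F N] [Nontrivial N]
    (h : IsHermitianPairing τ σ ε B) (h' : IsHermitianPairing τ σ ε B')
    (hB : NondegRight B) (hB' : NondegRight B')
    (j : N →ₗ[R] V) (j' : N →ₗ[R] V') (hj : NondegRight fun a b => B (j a) (j b))
    (hjj' : ∀ a b, B' (j' a) (j' b) = B (j a) (j b)) : Reduces R B B' := by
  have hj' : NondegRight fun a b => B' (j' a) (j' b) := by simpa only [hjj'] using hj
  have : Finite N := Module.finite_of_finite F
  exact ⟨_, _, h.orth_range_ne_top j hj, h'.orth_range_ne_top j' hj', h.nondegRight_orth hB j hj,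
    h'.nondegRight_orth hB' j' hj',
    fun hc => hc.cancel (h.splitEquiv j hj) (h'.splitEquiv j' hj'),
    Isometric.of_orth h h' j j' hj hjj'⟩

variable [Finite F] [FiniteDimensional F V]

/-- If `V` has a simple submodule that is not totally isotropic, then an isometric copy of it
splits off from both `V` and `V'`. -/
theorem Reduces.of_simple_ne_zero [IsSemisimpleModule R V']
    (h : IsHermitianPairing τ σ ε B) (h' : IsHermitianPairing τ σ ε B')
    (hB : NondegRight B) (hB' : NondegRight B') (hτ : Function.Involutive τ)
    (hc : SameHomCount R V V') (hfix : FixedIsotropic τ B)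
    (W : Submodule R V) [IsSimpleModule R W] (hW : ∃ u v : W, B u v ≠ 0) : Reduces R B B' := by
  have : Finite V := Module.finite_of_finite F
  have : Nontrivial W := IsSimpleModule.nontrivial R W
  have hBW : IsHermitianPairing τ σ ε (restrictForm B W) := h.restrict W
  have hWr : NondegRight (restrictForm B W) := hBW.nondegRight_of_isSimpleModule hW
  have hWl : NondegLeft (restrictForm B W) := hBW.nondegLeft hWr
  have hne : ∃ (r : R) (w : W), τ r • w ≠ r • w := by
    by_contra! hall
    obtain ⟨w, hw⟩ := exists_ne (0 : W)
    refine hw (hWr w fun u => ?_)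
    obtain ⟨r, rfl⟩ := IsSimpleModule.toSpanSingleton_surjective R hw u
    exact hfix w (fun s => congrArg Subtype.val (hall s w)) r
  -- It suffices to embed `W` in `V'` with an image that is not totally isotropic.
  suffices hθ : ∃ θ : W →ₗ[R] V', ∃ u v, B' (θ u) (θ v) ≠ 0 by
    obtain ⟨θ, hθ⟩ := hθ
    obtain ⟨a, ha⟩ := exists_smul_isometry_of_isSimpleModule hBW (h'.comp θ) hθ hτ hne
    exact Reduces.of_embeddings h h' hB hB' W.subtype (θ ∘ₗ LinearMap.lsmul R W a) hWr ha
  obtain ⟨θ, hθ⟩ := hc.exists_injective W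
  by_contra! hall
  obtain ⟨w, hw⟩ := exists_ne (0 : W)
  have hθw : θ w ≠ 0 := fun h0 => hw (hθ (by rw [h0, map_zero]))
  obtain ⟨U, hU, w₁, u₁, hwu⟩ := h'.exists_simple_pairing hB' θ hθw
  -- The pairing with `θ W` identifies `U` with `W`.
  obtain ⟨T, hT⟩ := hBW.exists_factor hWl hWr (h'.toIsAdjointPairing.comp θ U.subtype)
  have hT0 : T ≠ 0 := by
    rintro rfl
    refine hwu ?_
    have := hT w₁ u₁
    rwa [LinearMap.zero_apply, hBW.zero_right, eq_comm] at this
  let e := LinearEquiv.ofBijective T (LinearMap.bijective_of_ne_zero hT0)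
  obtain ⟨a, u, v, huv⟩ := h'.exists_graph_ne_zero hne θ (U.subtype ∘ₗ e.symm.toLinearMap)
    (hall θ) (hall _) ⟨w₁, e u₁, by simpa using hwu⟩
  exact huv (hall _ u v)

/-- If all simple submodules of `V` and `V'` are totally isotropic, then isometric hyperbolic
submodules, each the sum of two dual simple modules, split off. -/
theorem Reduces.of_simples_isotropic [IsSemisimpleModule R V] [IsSemisimpleModule R V']
    [Nontrivial V]
    (h : IsHermitianPairing τ σ ε B) (h' : IsHermitianPairing τ σ ε B')
    (hB : NondegRight B) (hB' : NondegRight B') (hc : SameHomCount R V V')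
    (hiso : ∀ W : Submodule R V, IsSimpleModule R W → ∀ u v : W, B u v = 0)
    (hiso' : ∀ W : Submodule R V', IsSimpleModule R W → ∀ u v : W, B' u v = 0) :
    Reduces R B B' := by
  have : Finite V := Module.finite_of_finite F
  obtain ⟨W, hW⟩ := IsSemisimpleModule.exists_simple_submodule R V
  have : Nontrivial W := IsSimpleModule.nontrivial R W
  obtain ⟨w, hw⟩ := exists_ne (0 : W)
  have hw' : W.subtype w ≠ 0 := fun h0 => hw (Subtype.ext h0)
  obtain ⟨U, hU, w₁, u₁, hwu⟩ := h.exists_simple_pairing hB W.subtype hw'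
  obtain ⟨θ, hθ⟩ := hc.exists_injective W
  have hθw : θ w ≠ 0 := fun h0 => hw (hθ (by rw [h0, map_zero]))
  obtain ⟨U', hU', w₂, u₂, hwu'⟩ := h'.exists_simple_pairing hB' θ hθw
  have hP : IsAdjointPairing τ fun (w : W) (u : U) => B w u :=
    h.toIsAdjointPairing.comp W.subtype U.subtype
  have hP' : IsAdjointPairing τ fun (w : W) (u : U') => B' (θ w) u :=
    h'.toIsAdjointPairing.comp θ U'.subtype
  obtain ⟨T, hT⟩ := hP'.exists_factor (hP'.nondegLeft_of_isSimpleModule ⟨w₂, u₂, hwu'⟩)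
    (hP'.nondegRight_of_isSimpleModule ⟨w₂, u₂, hwu'⟩) hP
  have hPl := hP.nondegLeft_of_isSimpleModule ⟨w₁, u₁, hwu⟩
  have hPr := hP.nondegRight_of_isSimpleModule ⟨w₁, u₁, hwu⟩
  have hθ0 : ∀ a b, B' (θ a) (θ b) = 0 := fun a b =>
    hiso' (LinearMap.range θ) (IsSimpleModule.congr (LinearEquiv.ofInjective θ hθ).symm)
      ⟨θ a, a, rfl⟩ ⟨θ b, b, rfl⟩
  have hB1 : ∀ p q : W × U, B (W.subtype.coprod U.subtype p) (W.subtype.coprod U.subtype q)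
      = B p.1 q.2 + B p.2 q.1 := by
    intro p q
    simp only [LinearMap.coprod_apply, Submodule.subtype_apply, h.add_left, h.add_right,
      hiso W hW, hiso U hU]
    ring
  refine Reduces.of_embeddings (N := W × U) h h' hB hB' (W.subtype.coprod U.subtype)
    (θ.coprod (U'.subtype ∘ₗ T)) ?_ fun p q => ?_
  · intro p hp
    refine Prod.ext (hPl _ fun u => ?_) (hPr _ fun w => ?_)
    · have := hp (0, u)
      simp only [hB1, Submodule.coe_zero, h.zero_left, zero_add] at this
      exact h.eq_zero_comm this
    · have := hp (w, 0)
      simpa only [hB1, Submodule.coe_zero, h.zero_left, add_zero] using this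
  · have h2 : B' (T p.2) (θ q.1) = B p.2 q.1 := by
      rw [h'.symm, hT, ← h.symm]
    rw [hB1]
    simp only [LinearMap.coprod_apply, LinearMap.comp_apply, Submodule.subtype_apply,
      h'.add_left, h'.add_right, hiso' U' hU', hθ0, hT, h2]
    ring

/-- Finite semisimple modules with the same homomorphism counts, carrying nondegenerate hermitian
pairings that are isotropic wherever the adjoint involution is trivial, are isometric. -/
theorem isometric_of_sameHomCount [FiniteDimensional F V'] [IsSemisimpleRing R]
    (hτ : Function.Involutive τ)
    (h : IsHermitianPairing τ σ ε B) (h' : IsHermitianPairing τ σ ε B')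
    (hB : NondegRight B) (hB' : NondegRight B') (hc : SameHomCount R V V')
    (hfix : FixedIsotropic τ B) (hfix' : FixedIsotropic τ B') : Isometric R B B' := by
  induction hn : Nat.card V using Nat.strong_induction_on generalizing V V' with
  | _ n ih =>
  subst hn
  have : Finite V := Module.finite_of_finite F
  have : Finite V' := Module.finite_of_finite F
  rcases subsingleton_or_nontrivial V with hV | hV
  · have h1 := hc V'
    -- Only one homomorphism ends in `V = 0`, so the identity of `V'` is zero.
    have hid : (LinearMap.id : V' →ₗ[R] V') = 0 := by
      have h2 : Nat.card (V' →ₗ[R] V) = 1 :=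
        Nat.card_eq_one_iff_unique.mpr
          ⟨⟨fun a b => LinearMap.ext fun x => Subsingleton.elim _ _⟩, ⟨0⟩⟩
      rw [h2, eq_comm, Nat.card_eq_one_iff_unique] at h1
      exact h1.1.elim _ _
    have hV' : Subsingleton V' :=
      subsingleton_of_forall_eq 0 fun v => LinearMap.congr_fun hid v
    refine ⟨LinearEquiv.ofSubsingleton V V', fun u v => ?_⟩
    rw [Subsingleton.elim u 0, Subsingleton.elim v 0, map_zero, h'.zero_left, h.zero_left]
  · have hred : Reduces R B B' := by
      by_cases h1 : ∃ W : Submodule R V, IsSimpleModule R W ∧ ∃ u v : W, B u v ≠ 0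
      · obtain ⟨W, hW, hne⟩ := h1
        exact Reduces.of_simple_ne_zero h h' hB hB' hτ hc hfix W hne
      by_cases h2 : ∃ W : Submodule R V', IsSimpleModule R W ∧ ∃ u v : W, B' u v ≠ 0
      · obtain ⟨W, hW, hne⟩ := h2
        exact (Reduces.of_simple_ne_zero h' h hB' hB hτ hc.symm hfix' W hne).symm
      push Not at h1 h2
      exact Reduces.of_simples_isotropic h h' hB hB' hc h1 h2
    obtain ⟨Y, Y', hY, -, hBY, hBY', hcY, himp⟩ := hred
    have hlt : Nat.card Y < Nat.card V :=
      Finite.card_subtype_lt (p := (· ∈ Y)) (SetLike.exists_not_mem_of_ne_top Y hY).choose_spec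
    exact himp (ih _ hlt (h.restrict Y) (h'.restrict Y') hBY hBY' (hcY hc) (hfix.restrict Y)
      (hfix'.restrict Y') rfl)

end Main

/-! ### Symmetric forms over finite fields of odd characteristic -/

section Symmetric

open Module

variable {F : Type*} [Field F] {V V' : Type*} [AddCommGroup V] [Module F V]
  [AddCommGroup V'] [Module F V'] {B : V → V → F} {B' : V' → V' → F}

/-- Symmetric bilinear forms, as hermitian pairings over the field itself. -/
abbrev IsSymmPairing {F V : Type*} [Field F] [AddCommGroup V] [Module F V] (B : V → V → F) :
    Prop :=
  IsHermitianPairing (R := F) (RingHom.id F) (RingHom.id F) 1 B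

theorem IsSymmPairing.comm (h : IsSymmPairing B) (u v : V) : B u v = B v u := by
  simpa using h.symm v u

theorem IsSymmPairing.smul_right (h : IsSymmPairing B) (c : F) (u v : V) :
    B u (c • v) = c * B u v := by
  rw [h.comm, h.smul_left, h.comm]

theorem IsSymmPairing.exists_self_ne_zero [Nontrivial V] (h : IsSymmPairing B)
    (hB : NondegRight B) (h2 : (2 : F) ≠ 0) : ∃ v, B v v ≠ 0 := by
  by_contra! hall
  obtain ⟨v, hv⟩ := exists_ne (0 : V)
  refine hv (hB v fun u => ?_)
  have h1 := hall (u + v)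
  rw [h.add_left, h.add_right, h.add_right, hall, hall, h.comm v u] at h1
  exact (mul_eq_zero.mp (by linear_combination h1 : (2 : F) * B u v = 0)).resolve_left h2

/-! ### Splitting off a line -/

theorem IsSymmPairing.nondegRight_line (h : IsSymmPairing B) {v : V} (hv : B v v ≠ 0) :
    NondegRight fun a b : F =>
      B (LinearMap.toSpanSingleton F V v a) (LinearMap.toSpanSingleton F V v b) := by
  intro a ha
  have := ha 1
  simp only [LinearMap.toSpanSingleton_apply, one_smul, h.smul_right] at this
  exact (mul_eq_zero.mp this).resolve_right hv

/-- The orthogonal complement of a vector. -/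
abbrev IsSymmPairing.lineOrth (h : IsSymmPairing B) (v : V) : Submodule F V :=
  IsHermitianPairing.orth h (LinearMap.range (LinearMap.toSpanSingleton F V v))

theorem IsSymmPairing.apply_lineOrth (h : IsSymmPairing B) (v : V) (z : h.lineOrth v) :
    B v z = 0 := by
  simpa using h.mem_orth_range.mp z.2 1

theorem IsSymmPairing.nondegRight_lineOrth (h : IsSymmPairing B) (hB : NondegRight B) {v : V}
    (hv : B v v ≠ 0) : NondegRight (restrictForm B (h.lineOrth v)) :=
  h.nondegRight_orth hB _ (h.nondegRight_line hv)

theorem IsSymmPairing.isometric_of_lineOrth (h : IsSymmPairing B) (h' : IsSymmPairing B')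
    {v : V} {v' : V'} (hv : B v v ≠ 0) (hvv' : B' v' v' = B v v)
    (hiso : Isometric F (restrictForm B (h.lineOrth v)) (restrictForm B' (h'.lineOrth v'))) :
    Isometric F B B' := by
  refine Isometric.of_orth h h' _ _ (h.nondegRight_line hv) (fun a b => ?_) hiso
  simp only [LinearMap.toSpanSingleton_apply, h.smul_right, h'.smul_right, h.smul_left,
    h'.smul_left, hvv']

section

variable [FiniteDimensional F V] [FiniteDimensional F V']

theorem IsSymmPairing.finrank_lineOrth (h : IsSymmPairing B) {v : V} (hv : B v v ≠ 0) :
    1 + finrank F (h.lineOrth v) = finrank F V := by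
  have := (h.splitEquiv _ (h.nondegRight_line hv)).finrank_eq
  rwa [finrank_prod, finrank_self] at this

theorem IsSymmPairing.isometric_of_finrank_eq_zero (h : IsSymmPairing B) (h' : IsSymmPairing B')
    (hV : finrank F V = 0) (hV' : finrank F V' = 0) : Isometric F B B' := by
  have := finrank_zero_iff.mp hV
  have := finrank_zero_iff.mp hV'
  refine ⟨LinearEquiv.ofSubsingleton V V', fun u v => ?_⟩
  rw [Subsingleton.elim u 0, Subsingleton.elim v 0, map_zero, h'.zero_left, h.zero_left]

theorem IsSymmPairing.isometric_of_finrank_eq_one (h : IsSymmPairing B) (h' : IsSymmPairing B')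
    (hV : finrank F V = 1) (hV' : finrank F V' = 1) {v : V} {v' : V'} (hv : B v v ≠ 0) {s : F}
    (hs : B v v = s ^ 2 * B' v' v') : Isometric F B B' := by
  have hs' : B' (s • v') (s • v') = B v v := by
    rw [h'.smul_left, h'.smul_right, hs]
    ring
  refine h.isometric_of_lineOrth h' hv hs' (IsSymmPairing.isometric_of_finrank_eq_zero
    (h.restrict _) (h'.restrict _) ?_ ?_)
  · have := h.finrank_lineOrth hv
    omega
  · have := h'.finrank_lineOrth (hs'.trans_ne hv)
    omega

/-! ### Values of forms over finite fields -/

variable [Finite F]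

/-- A nondegenerate form in at least two variables represents every element of the field. -/
theorem IsSymmPairing.exists_self_eq (h : IsSymmPairing B) (hB : NondegRight B) (h2 : (2 : F) ≠ 0)
    (hV : 2 ≤ finrank F V) (a : F) : ∃ v, B v v = a := by
  have : Fintype F := Fintype.ofFinite F
  have : Nontrivial V := nontrivial_of_finrank_pos (R := F) (by omega)
  obtain ⟨u, hu⟩ := h.exists_self_ne_zero hB h2
  have hdim := h.finrank_lineOrth hu
  have : Nontrivial (h.lineOrth u) := nontrivial_of_finrank_pos (R := F) (by omega)
  obtain ⟨w, hw⟩ := IsSymmPairing.exists_self_ne_zero (h.restrict _)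
    (h.nondegRight_lineOrth hB hu) h2
  have hw' : B w w ≠ 0 := hw
  have huw := h.apply_lineOrth u w
  have hodd : Fintype.card F % 2 = 1 := by
    refine FiniteField.odd_card_of_char_ne_two fun hchar => h2 ?_
    have := ringChar.Nat.cast_ringChar (R := F)
    rw [hchar] at this
    exact_mod_cast this
  obtain ⟨x, y, hxy⟩ := FiniteField.exists_root_sum_quadratic
    (f := Polynomial.C (B u u) * Polynomial.X ^ 2 + Polynomial.C 0 * Polynomial.X
      + Polynomial.C 0)
    (g := Polynomial.C (B w w) * Polynomial.X ^ 2 + Polynomial.C 0 * Polynomial.X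
      + Polynomial.C (-a))
    (Polynomial.degree_quadratic hu) (Polynomial.degree_quadratic hw') hodd
  simp only [Polynomial.eval_add, Polynomial.eval_mul, Polynomial.eval_C, Polynomial.eval_pow,
    Polynomial.eval_X] at hxy
  refine ⟨x • u + y • (w : V), ?_⟩
  rw [h.add_left, h.add_right, h.add_right, h.smul_left, h.smul_left, h.smul_left, h.smul_left,
    h.smul_right, h.smul_right, h.smul_right, h.smul_right, h.comm w u, huw]
  linear_combination hxy

theorem IsSymmPairing.exists_isotropic (h : IsSymmPairing B) (hB : NondegRight B)
    (h2 : (2 : F) ≠ 0) (hV : 3 ≤ finrank F V) : ∃ v, v ≠ 0 ∧ B v v = 0 := by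
  have : Nontrivial V := nontrivial_of_finrank_pos (R := F) (by omega)
  obtain ⟨u, hu⟩ := h.exists_self_ne_zero hB h2
  have hdim := h.finrank_lineOrth hu
  obtain ⟨w, hw⟩ := IsSymmPairing.exists_self_eq (h.restrict _)
    (h.nondegRight_lineOrth hB hu) h2 (by omega) (-B u u)
  have hw' : B w w = -B u u := hw
  have huw := h.apply_lineOrth u w
  refine ⟨u + w, fun h0 => hu ?_, ?_⟩
  · have : B u (u + w) = 0 := by rw [h0, h.zero_right]
    rwa [h.add_right, huw, add_zero] at this
  · rw [h.add_left, h.add_right, h.add_right, huw, h.comm w u, huw, hw']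
    ring

end

theorem exists_sq_mul_eq_of_isSquare_iff {F : Type*} [Field F] [Finite F] {a b : F}
    (ha : a ≠ 0) (hb : b ≠ 0) (hab : IsSquare a ↔ IsSquare b) : ∃ s, a = s ^ 2 * b := by
  classical
  have : Fintype F := Fintype.ofFinite F
  have hsq : IsSquare (a * b) := by
    rw [← quadraticChar_one_iff_isSquare (mul_ne_zero ha hb), map_mul]
    by_cases h : IsSquare a
    · rw [(quadraticChar_one_iff_isSquare ha).mpr h,
        (quadraticChar_one_iff_isSquare hb).mpr (hab.mp h), one_mul]
    · rw [quadraticChar_neg_one_iff_not_isSquare.mpr h,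
        quadraticChar_neg_one_iff_not_isSquare.mpr (fun h' => h (hab.mpr h'))]
      norm_num
  obtain ⟨r, hr⟩ := hsq
  refine ⟨r / b, ?_⟩
  field_simp
  linear_combination hr

/-! ### The discriminant -/

/-- The Gram matrix of a form in a family of vectors. -/
def gramMatrix {F V ι : Type*} (B : V → V → F) (b : ι → V) : Matrix ι ι F :=
  Matrix.of fun i j => B (b i) (b j)

theorem IsSymmPairing.exists_det_gramMatrix_eq {ι κ : Type*} [Fintype ι] [DecidableEq ι]
    [Fintype κ] [DecidableEq κ] (h : IsSymmPairing B) (b : Basis ι F V) (c : Basis κ F V) :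
    ∃ s : F, s ≠ 0 ∧ (gramMatrix B b).det = s ^ 2 * (gramMatrix B c).det := by
  let β : LinearMap.BilinForm F V := LinearMap.mk₂ F B h.add_left
    (fun c u v => by rw [h.smul_left, smul_eq_mul]) h.add_right
    (fun c u v => by rw [h.smul_right, smul_eq_mul])
  let e := c.indexEquiv b
  have h1 := LinearMap.BilinForm.toMatrix_mul_basis_toMatrix (c.reindex e) b β
  have h2 : LinearMap.BilinForm.toMatrix b β = gramMatrix B b := by
    ext i j
    simp [gramMatrix, β]
  have h3 : LinearMap.BilinForm.toMatrix (c.reindex e) β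
      = (gramMatrix B c).submatrix e.symm e.symm := by
    ext i j
    simp [gramMatrix, β]
  rw [h2, h3] at h1
  refine ⟨((c.reindex e).toMatrix b).det, ?_, ?_⟩
  · have := congrArg Matrix.det ((c.reindex e).toMatrix_mul_toMatrix_flip b)
    rw [Matrix.det_mul, Matrix.det_one] at this
    exact left_ne_zero_of_mul_eq_one this
  · rw [← h1, Matrix.det_mul, Matrix.det_mul, Matrix.det_transpose,
      Matrix.det_submatrix_equiv_self]
    ring

theorem IsSymmPairing.det_gramMatrix_ne_zero {ι : Type*} [Fintype ι] [DecidableEq ι]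
    (h : IsSymmPairing B) (hB : NondegRight B) (b : Basis ι F V) : (gramMatrix B b).det ≠ 0 := by
  let β : LinearMap.BilinForm F V := LinearMap.mk₂ F B h.add_left
    (fun c u v => by rw [h.smul_left, smul_eq_mul]) h.add_right
    (fun c u v => by rw [h.smul_right, smul_eq_mul])
  have h2 : LinearMap.BilinForm.toMatrix b β = gramMatrix B b := by
    ext i j
    simp [gramMatrix, β]
  have hnd : β.Nondegenerate :=
    ⟨fun v hv => h.nondegLeft hB v hv, fun v hv => hB v hv⟩
  rw [← h2]
  exact (LinearMap.BilinForm.nondegenerate_iff_det_ne_zero b).mp hnd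

/-- Completing a basis of the complement of `v`, where `B v v = 1`, by `v` does not change the
discriminant. -/
theorem IsSymmPairing.exists_det_lineOrth [FiniteDimensional F V] {n : ℕ} (h : IsSymmPairing B)
    {v : V} (hv : B v v = 1) (c : Basis (Fin n) F (h.lineOrth v)) (b : Basis (Fin (n + 1)) F V) :
    ∃ s : F, s ≠ 0 ∧ (gramMatrix B b).det
      = s ^ 2 * (gramMatrix (restrictForm B (h.lineOrth v)) c).det := by
  have hv0 : B v v ≠ 0 := hv.trans_ne one_ne_zero
  let d : Basis (Unit ⊕ Fin n) F V :=
    ((Basis.singleton Unit F).prod c).map (h.splitEquiv _ (h.nondegRight_line hv0))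
  obtain ⟨s, hs0, hs⟩ := h.exists_det_gramMatrix_eq b d
  refine ⟨s, hs0, hs.trans ?_⟩
  have hd : gramMatrix B d
      = Matrix.fromBlocks 1 0 0 (gramMatrix (restrictForm B (h.lineOrth v)) c) := by
    ext i j
    rcases i with i | i <;> rcases j with j | j <;>
      simp [gramMatrix, d, h.apply_splitEquiv, h.zero_left, h.zero_right, hv, restrictForm]
  rw [hd, Matrix.det_fromBlocks_zero₂₁, Matrix.det_one, one_mul]

/-- Forms whose discriminants agree up to a square are isometric: split off vectors `v` with
`B v v = 1` until one dimension is left. -/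
theorem IsSymmPairing.isometric_of_det_eq [Finite F] (h2 : (2 : F) ≠ 0) (n : ℕ) :
    ∀ {V V' : Type*} [AddCommGroup V] [Module F V] [AddCommGroup V'] [Module F V']
      {B : V → V → F} {B' : V' → V' → F}, IsSymmPairing B → IsSymmPairing B' →
      NondegRight B → NondegRight B' → ∀ (b : Basis (Fin (n + 1)) F V)
      (b' : Basis (Fin (n + 1)) F V') {s : F},
      (gramMatrix B b).det = s ^ 2 * (gramMatrix B' b').det → Isometric F B B' := by
  induction n with
  | zero =>
    intro V V' _ _ _ _ B B' h h' hB hB' b b' s hs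
    have := b.finiteDimensional_of_finite
    have := b'.finiteDimensional_of_finite
    have hne := h.det_gramMatrix_ne_zero hB b
    simp only [Nat.reduceAdd, Matrix.det_unique, gramMatrix, Matrix.of_apply] at hs hne
    exact h.isometric_of_finrank_eq_one h' (by simpa using finrank_eq_card_basis b)
      (by simpa using finrank_eq_card_basis b') hne hs
  | succ n ih =>
    intro V V' _ _ _ _ B B' h h' hB hB' b b' s hs
    have := b.finiteDimensional_of_finite
    have := b'.finiteDimensional_of_finite
    have hV : finrank F V = n + 1 + 1 := by simpa using finrank_eq_card_basis b
    have hV' : finrank F V' = n + 1 + 1 := by simpa using finrank_eq_card_basis b'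
    obtain ⟨v, hv⟩ := h.exists_self_eq hB h2 (by omega) 1
    obtain ⟨v', hv'⟩ := h'.exists_self_eq hB' h2 (by omega) 1
    have hv0 : B v v ≠ 0 := hv.trans_ne one_ne_zero
    have hv0' : B' v' v' ≠ 0 := hv'.trans_ne one_ne_zero
    have hdim := h.finrank_lineOrth hv0
    have hdim' := h'.finrank_lineOrth hv0'
    let c := finBasisOfFinrankEq F (h.lineOrth v) (by omega : _ = n + 1)
    let c' := finBasisOfFinrankEq F (h'.lineOrth v') (by omega : _ = n + 1)
    obtain ⟨t, ht, hbt⟩ := h.exists_det_lineOrth hv c b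
    obtain ⟨t', ht', hbt'⟩ := h'.exists_det_lineOrth hv' c' b'
    refine h.isometric_of_lineOrth h' hv0 (hv'.trans hv.symm) (ih (s := s * t' / t) (h.restrict _)
      (h'.restrict _) (h.nondegRight_lineOrth hB hv0) (h'.nondegRight_lineOrth hB' hv0') c c' ?_)
    rw [hbt, hbt'] at hs
    field_simp
    linear_combination hs

end Symmetric

/-! ### Hyperbolic planes and the Witt index -/

section Witt

open Module

variable {F : Type*} [Field F] {V V' : Type*} [AddCommGroup V] [Module F V]
  [AddCommGroup V'] [Module F V'] {B : V → V → F} {B' : V' → V' → F}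

/-- `v` and `u` are a hyperbolic pair: singular vectors with `B v u = 1`. -/
def IsHyperbolicPair (B : V → V → F) (v u : V) : Prop :=
  B v v = 0 ∧ B u u = 0 ∧ B v u = 1

theorem IsSymmPairing.exists_isHyperbolicPair (h : IsSymmPairing B) (hB : NondegRight B)
    (h2 : (2 : F) ≠ 0) {v : V} (hv : v ≠ 0) (hvv : B v v = 0) : ∃ u, IsHyperbolicPair B v u := by
  obtain ⟨u₁, hu1⟩ : ∃ u₁, B v u₁ = 1 := by
    obtain ⟨u, hu⟩ : ∃ u, B v u ≠ 0 := by
      by_contra! hall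
      exact hv (h.nondegLeft hB v hall)
    exact ⟨(B v u)⁻¹ • u, by rw [h.smul_right, inv_mul_cancel₀ hu]⟩
  refine ⟨u₁ - (B u₁ u₁ / 2) • v, hvv, ?_, ?_⟩
  · rw [h.sub_left, h.sub_right, h.sub_right, h.smul_left, h.smul_left, h.smul_right,
      h.smul_right, hvv, h.comm u₁ v, hu1]
    field_simp
    ring
  · rw [h.sub_right, h.smul_right, hvv, hu1, mul_zero, sub_zero]

/-- The linear map from the plane `F × F` with coordinate vectors `v` and `u`. -/
def planeMap (F : Type*) {V : Type*} [Field F] [AddCommGroup V] [Module F V] (v u : V) :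
    F × F →ₗ[F] V :=
  (LinearMap.toSpanSingleton F V v).coprod (LinearMap.toSpanSingleton F V u)

theorem planeMap_apply (v u : V) (p : F × F) : planeMap F v u p = p.1 • v + p.2 • u := by
  simp [planeMap]

theorem IsSymmPairing.apply_planeMap (h : IsSymmPairing B) {v u : V} (hvu : IsHyperbolicPair B v u)
    (p q : F × F) : B (planeMap F v u p) (planeMap F v u q) = p.1 * q.2 + p.2 * q.1 := by
  obtain ⟨h1, h2, h3⟩ := hvu
  simp only [planeMap_apply, h.add_left, h.add_right, h.smul_left, h.smul_right, h1, h2, h3,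
    h.comm u v]
  ring

theorem IsSymmPairing.nondegRight_plane (h : IsSymmPairing B) {v u : V}
    (hvu : IsHyperbolicPair B v u) :
    NondegRight fun p q => B (planeMap F v u p) (planeMap F v u q) := by
  intro p hp
  simp only [h.apply_planeMap hvu] at hp
  exact Prod.ext (by simpa using hp (0, 1)) (by simpa using hp (1, 0))

/-- The orthogonal complement of two vectors. -/
abbrev IsSymmPairing.planeOrth (h : IsSymmPairing B) (v u : V) : Submodule F V :=
  IsHermitianPairing.orth h (LinearMap.range (planeMap F v u))

theorem IsSymmPairing.mem_planeOrth (h : IsSymmPairing B) {v u z : V} :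
    z ∈ h.planeOrth v u ↔ B v z = 0 ∧ B u z = 0 := by
  rw [h.mem_orth_range]
  simp only [planeMap_apply, h.add_left, h.smul_left]
  constructor
  · intro hz
    exact ⟨by simpa using hz (1, 0), by simpa using hz (0, 1)⟩
  · rintro ⟨h1, h2⟩ p
    rw [h1, h2, mul_zero, mul_zero, add_zero]

theorem IsSymmPairing.nondegRight_planeOrth (h : IsSymmPairing B) (hB : NondegRight B) {v u : V}
    (hvu : IsHyperbolicPair B v u) : NondegRight (restrictForm B (h.planeOrth v u)) :=
  h.nondegRight_orth hB _ (h.nondegRight_plane hvu)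

theorem IsSymmPairing.isometric_of_planeOrth (h : IsSymmPairing B) (h' : IsSymmPairing B')
    {v u : V} {v' u' : V'} (hvu : IsHyperbolicPair B v u) (hvu' : IsHyperbolicPair B' v' u')
    (hiso : Isometric F (restrictForm B (h.planeOrth v u))
      (restrictForm B' (h'.planeOrth v' u'))) :
    Isometric F B B' := by
  refine Isometric.of_orth h h' _ _ (h.nondegRight_plane hvu) (fun p q => ?_) hiso
  rw [h.apply_planeMap hvu, h'.apply_planeMap hvu']

/-- A subspace is totally singular when the quadratic form vanishes on it. -/
def IsTotallySingular (B : V → V → F) (W : Submodule F V) : Prop :=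
  ∀ w ∈ W, B w w = 0

/-- `k` is the largest dimension of a totally singular subspace. -/
def IsWittIndex (B : V → V → F) (k : ℕ) : Prop :=
  IsGreatest {m | ∃ W : Submodule F V, IsTotallySingular B W ∧ finrank F W = m} k

theorem IsSymmPairing.apply_eq_zero_of_isTotallySingular (h : IsSymmPairing B) (h2 : (2 : F) ≠ 0)
    {W : Submodule F V} (hW : IsTotallySingular B W) {u v : V} (hu : u ∈ W) (hv : v ∈ W) :
    B u v = 0 := by
  have h1 := hW (u + v) (W.add_mem hu hv)
  rw [h.add_left, h.add_right, h.add_right, hW u hu, hW v hv, h.comm v u] at h1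
  exact (mul_eq_zero.mp (by linear_combination h1 : (2 : F) * B u v = 0)).resolve_left h2

theorem IsWittIndex.anisotropic (hm : IsWittIndex B 0) (h : IsSymmPairing B) {v : V}
    (hv : B v v = 0) : v = 0 := by
  by_contra hv0
  have hsing : IsTotallySingular B (F ∙ v) := by
    intro w hw
    obtain ⟨c, rfl⟩ := Submodule.mem_span_singleton.mp hw
    rw [h.smul_left, h.smul_right, hv, mul_zero, mul_zero]
  have := hm.2 ⟨_, hsing, rfl⟩
  rw [finrank_span_singleton hv0] at this
  omega

variable [FiniteDimensional F V]

theorem IsSymmPairing.finrank_planeOrth (h : IsSymmPairing B) {v u : V}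
    (hvu : IsHyperbolicPair B v u) : 2 + finrank F (h.planeOrth v u) = finrank F V := by
  have := (h.splitEquiv _ (h.nondegRight_plane hvu)).finrank_eq
  rwa [finrank_prod, finrank_prod, finrank_self] at this

theorem exists_isWittIndex (h : IsSymmPairing B) : ∃ k, IsWittIndex B k := by
  let S := {m | ∃ W : Submodule F V, IsTotallySingular B W ∧ finrank F W = m}
  have hne : S.Nonempty := ⟨_, ⊥, fun w hw => by
    rw [(Submodule.mem_bot F).mp hw, h.zero_left], rfl⟩
  have hbdd : BddAbove S := ⟨finrank F V, by
    rintro _ ⟨W, -, rfl⟩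
    exact W.finrank_le⟩
  exact ⟨sSup S, Nat.sSup_mem hne hbdd, fun m hm => le_csSup hbdd hm⟩

/-- Splitting off a hyperbolic plane through a vector of a totally singular subspace of the
largest dimension lowers the Witt index by one. -/
theorem IsSymmPairing.isWittIndex_planeOrth (h : IsSymmPairing B) (h2 : (2 : F) ≠ 0) {m : ℕ}
    (hm : IsWittIndex B (m + 1)) {S : Submodule F V} (hS : IsTotallySingular B S)
    (hSm : finrank F S = m + 1) {v u : V} (hv : v ∈ S) (hvu : IsHyperbolicPair B v u) :
    IsWittIndex (restrictForm B (h.planeOrth v u)) m := by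
  have hle : ∀ T : Submodule F (h.planeOrth v u),
      IsTotallySingular (restrictForm B (h.planeOrth v u)) T → finrank F T ≤ m := by
    intro T hT
    let f : F × T →ₗ[F] V := (LinearMap.toSpanSingleton F V v).coprod
      ((h.planeOrth v u).subtype ∘ₗ T.subtype)
    have hf : ∀ p, f p = p.1 • v + ((p.2 : h.planeOrth v u) : V) := fun p => by simp [f]
    have hinj : Function.Injective f := by
      rw [← LinearMap.ker_eq_bot, LinearMap.ker_eq_bot']
      intro p hp
      rw [hf] at hp
      have h1 : B u (p.1 • v + ((p.2 : h.planeOrth v u) : V)) = 0 := by rw [hp, h.zero_right]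
      rw [h.add_right, h.smul_right, (h.mem_planeOrth.mp (p.2 : h.planeOrth v u).2).2, h.comm u v,
        hvu.2.2, mul_one, add_zero] at h1
      rw [h1, zero_smul, zero_add] at hp
      exact Prod.ext h1 (Subtype.ext (Subtype.ext hp))
    have hsing : IsTotallySingular B (LinearMap.range f) := by
      rintro _ ⟨p, rfl⟩
      have h1 := (h.mem_planeOrth.mp (p.2 : h.planeOrth v u).2).1
      have h3 : B ((p.2 : h.planeOrth v u) : V) ((p.2 : h.planeOrth v u) : V) = 0 := hT _ p.2.2
      rw [hf, h.add_left, h.add_right, h.add_right, h.smul_left, h.smul_left, h.smul_right,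
        h.smul_right, hvu.1, h.comm _ v, h1, h3]
      ring
    have := hm.2 ⟨_, hsing, rfl⟩
    rw [LinearMap.finrank_range_of_inj hinj, finrank_prod, finrank_self] at this
    omega
  let T : Submodule F (h.planeOrth v u) := S.comap (h.planeOrth v u).subtype
  have hT : IsTotallySingular (restrictForm B (h.planeOrth v u)) T := fun w hw => hS _ hw
  refine ⟨⟨T, hT, le_antisymm (hle T hT) ?_⟩, ?_⟩
  · -- Projecting `S` along `v` embeds it in `F × T`.
    have hproj : ∀ s : S, (s : V) - B u s • v ∈ h.planeOrth v u := fun s => by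
      refine h.mem_planeOrth.mpr ⟨?_, ?_⟩
      · rw [h.sub_right, h.smul_right, hvu.1, mul_zero, sub_zero]
        exact h.apply_eq_zero_of_isTotallySingular h2 hS hv s.2
      · rw [h.sub_right, h.smul_right, h.comm u v, hvu.2.2, mul_one, sub_self]
    let g : S →ₗ[F] F × T :=
      { toFun := fun s => (B u s, ⟨⟨s - B u s • v, hproj s⟩,
          S.sub_mem s.2 (S.smul_mem _ hv)⟩)
        map_add' := fun s t => by
          refine Prod.ext (h.add_right _ _ _) (Subtype.ext (Subtype.ext ?_))
          simp only [Submodule.coe_add, h.add_right, Prod.snd_add]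
          module
        map_smul' := fun c s => by
          refine Prod.ext (h.smul_right _ _ _) (Subtype.ext (Subtype.ext ?_))
          simp only [Submodule.coe_smul, h.smul_right, Prod.smul_snd, RingHom.id_apply]
          module }
    have hg : Function.Injective g := by
      intro s t hst
      have h1 : B u s = B u t := congrArg Prod.fst hst
      have h3 : (s : V) - B u s • v = t - B u t • v :=
        congrArg (fun p : F × T => ((p.2 : h.planeOrth v u) : V)) hst
      rw [h1, sub_left_inj] at h3
      exact Subtype.ext h3
    have := LinearMap.finrank_le_finrank_of_injective hg
    rw [finrank_prod, finrank_self, hSm] at this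
    omega
  · rintro _ ⟨W, hW, rfl⟩
    exact hle W hW

/-- A form of positive Witt index splits off a hyperbolic plane. -/
theorem IsSymmPairing.exists_plane (h : IsSymmPairing B) (hB : NondegRight B) (h2 : (2 : F) ≠ 0)
    {m : ℕ} (hm : IsWittIndex B (m + 1)) : ∃ v u, IsHyperbolicPair B v u ∧
      IsWittIndex (restrictForm B (h.planeOrth v u)) m := by
  obtain ⟨S, hS, hSm⟩ := hm.1
  have : Nontrivial S := nontrivial_of_finrank_pos (R := F) (by omega)
  obtain ⟨v, hv⟩ := exists_ne (0 : S)
  obtain ⟨u, hu⟩ := h.exists_isHyperbolicPair hB h2 (v := v) (fun h0 => hv (Subtype.ext h0))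
    (hS v v.2)
  exact ⟨v, u, hu, h.isWittIndex_planeOrth h2 hm hS hSm v.2 hu⟩

omit [FiniteDimensional F V] in
theorem IsWittIndex.not_isSquare_neg (hm : IsWittIndex B 0) (h : IsSymmPairing B) {v : V}
    (hv : B v v = 1) {w : h.lineOrth v} (hw : w ≠ 0) : ¬ IsSquare (-B w w) := by
  rintro ⟨s, hs⟩
  have hvw := h.apply_lineOrth v w
  have h0 : s • v + (w : V) = 0 := hm.anisotropic h (by
    rw [h.add_left, h.add_right, h.add_right, h.smul_left, h.smul_left, h.smul_right,
      h.smul_right, hv, h.comm w v, hvw]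
    linear_combination -hs)
  have hww : B w (s • v + w) = 0 := by rw [h0, h.zero_right]
  rw [h.add_right, h.smul_right, h.comm w v, hvw, mul_zero, zero_add] at hww
  exact hw (Subtype.ext (hm.anisotropic h hww))

variable [FiniteDimensional F V'] [Finite F]

/-- Anisotropic planes over a finite field of odd characteristic are isometric: each has an
orthogonal basis with values `1` and `p`, where `-p` is not a square. -/
theorem IsSymmPairing.isometric_of_anisotropic (h : IsSymmPairing B) (h' : IsSymmPairing B')
    (hB : NondegRight B) (hB' : NondegRight B') (h2 : (2 : F) ≠ 0)
    (hm : IsWittIndex B 0) (hm' : IsWittIndex B' 0)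
    (hV : finrank F V = 2) (hV' : finrank F V' = 2) : Isometric F B B' := by
  obtain ⟨v, hv⟩ := h.exists_self_eq hB h2 hV.ge 1
  obtain ⟨v', hv'⟩ := h'.exists_self_eq hB' h2 hV'.ge 1
  have hv0 : B v v ≠ 0 := hv.trans_ne one_ne_zero
  have hv0' : B' v' v' ≠ 0 := hv'.trans_ne one_ne_zero
  have hdim := h.finrank_lineOrth hv0
  have hdim' := h'.finrank_lineOrth hv0'
  have : Nontrivial (h.lineOrth v) := nontrivial_of_finrank_pos (R := F) (by omega)
  have : Nontrivial (h'.lineOrth v') := nontrivial_of_finrank_pos (R := F) (by omega)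
  obtain ⟨w, hw⟩ := exists_ne (0 : h.lineOrth v)
  obtain ⟨w', hw'⟩ := exists_ne (0 : h'.lineOrth v')
  have hsq := hm.not_isSquare_neg h hv hw
  have hsq' := hm'.not_isSquare_neg h' hv' hw'
  have hne : -B w w ≠ 0 := fun h0 => hsq (h0 ▸ IsSquare.zero)
  have hne' : -B' w' w' ≠ 0 := fun h0 => hsq' (h0 ▸ IsSquare.zero)
  obtain ⟨s, hs⟩ := exists_sq_mul_eq_of_isSquare_iff hne hne'
    ⟨fun h => absurd h hsq, fun h => absurd h hsq'⟩
  refine h.isometric_of_lineOrth h' hv0 (hv'.trans hv.symm)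
    (IsSymmPairing.isometric_of_finrank_eq_one (h.restrict _) (h'.restrict _) (by omega)
      (by omega) (v := w) (v' := w') (neg_ne_zero.mp hne) (s := s) ?_)
  change B w w = s ^ 2 * B' w' w'
  linear_combination -hs

omit [FiniteDimensional F V] [FiniteDimensional F V'] in
/-- In even dimension `2m + d`, with `d = 0` or `d = 2`, the Witt index `m` determines the form. -/
theorem IsSymmPairing.isometric_of_isWittIndex (h2 : (2 : F) ≠ 0) {d : ℕ} (hd : d = 0 ∨ d = 2)
    (m : ℕ) : ∀ {V V' : Type*} [AddCommGroup V] [Module F V] [AddCommGroup V'] [Module F V']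
      [FiniteDimensional F V] [FiniteDimensional F V']
      {B : V → V → F} {B' : V' → V' → F}, IsSymmPairing B → IsSymmPairing B' →
      NondegRight B → NondegRight B' → finrank F V = 2 * m + d → finrank F V' = 2 * m + d →
      IsWittIndex B m → IsWittIndex B' m → Isometric F B B' := by
  induction m with
  | zero =>
    intro V V' _ _ _ _ _ _ B B' h h' hB hB' hV hV' hm hm'
    rcases hd with rfl | rfl
    · exact h.isometric_of_finrank_eq_zero h' hV hV'
    · exact h.isometric_of_anisotropic h' hB hB' h2 hm hm' hV hV'
  | succ m ih =>
    intro V V' _ _ _ _ _ _ B B' h h' hB hB' hV hV' hm hm'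
    obtain ⟨v, u, hvu, hw⟩ := h.exists_plane hB h2 hm
    obtain ⟨v', u', hvu', hw'⟩ := h'.exists_plane hB' h2 hm'
    have hdim := h.finrank_planeOrth hvu
    have hdim' := h'.finrank_planeOrth hvu'
    exact h.isometric_of_planeOrth h' hvu hvu' (ih (h.restrict _) (h'.restrict _)
      (h.nondegRight_planeOrth hB hvu) (h'.nondegRight_planeOrth hB' hvu') (by omega) (by omega)
      hw hw')

omit [FiniteDimensional F V] in
/-- In dimension `2k` the Witt index is `k` or `k - 1`. -/
theorem IsSymmPairing.isWittIndex_eq_or (h2 : (2 : F) ≠ 0) (w : ℕ) :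
    ∀ {V : Type*} [AddCommGroup V] [Module F V] [FiniteDimensional F V] {B : V → V → F} (k : ℕ),
      IsSymmPairing B → NondegRight B → finrank F V = 2 * k → IsWittIndex B w →
      k = w ∨ k = w + 1 := by
  induction w with
  | zero =>
    intro V _ _ _ B k h hB hV hw
    by_contra! hk
    obtain ⟨v, hv, hvv⟩ := h.exists_isotropic hB h2 (by omega)
    exact hv (hw.anisotropic h hvv)
  | succ w ih =>
    intro V _ _ _ B k h hB hV hw
    obtain ⟨v, u, hvu, hw'⟩ := h.exists_plane hB h2 hw
    have hdim := h.finrank_planeOrth hvu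
    have := ih (k - 1) (h.restrict _) (h.nondegRight_planeOrth hB hvu) (by omega) hw'
    omega

end Witt

/-! ### The type of a symmetric form -/

section FormTypes

open Module

variable {F : Type*} [Field F] {σ : F →+* F} {V V' : Type*} [AddCommGroup V]
  [Module F V] [AddCommGroup V'] [Module F V'] [FiniteDimensional F V]
  {β : V →ₗ[F] V →ₛₗ[σ] F} {γ : V' →ₗ[F] V' →ₛₗ[σ] F}

theorem exists_hasType [Finite F] (h : IsSymmPairing fun u v => β u v)
    (hβ : NondegRight fun u v => β u v) (h2 : (2 : F) ≠ 0) : ∃ t, HasType β t := by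
  rcases Nat.even_or_odd' (finrank F V) with ⟨k, hk | hk⟩
  · obtain ⟨w, hw⟩ := exists_isWittIndex h
    rcases IsSymmPairing.isWittIndex_eq_or h2 w k h hβ hk hw with rfl | rfl
    · exact ⟨.plus, k, hk, hw⟩
    · exact ⟨.minus, w, hk, hw⟩
  · by_cases hsq : IsSquare (gramDet β (finBasisOfFinrankEq F V hk))
    · exact ⟨.oddSquare, k, _, hsq⟩
    · exact ⟨.oddNonsquare, k, _, hsq⟩

omit [FiniteDimensional F V] in
theorem HasWittIndex.of_equiv {k : ℕ} (hk : HasWittIndex β k) (e : V ≃ₗ[F] V')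
    (he : ∀ u v, γ (e u) (e v) = β u v) : HasWittIndex γ k := by
  refine ⟨?_, ?_⟩
  · obtain ⟨W, hW, hWk⟩ := hk.1
    refine ⟨W.map e.toLinearMap, ?_, ?_⟩
    · rintro _ ⟨w, hw, rfl⟩
      exact (he w w).trans (hW w hw)
    · rw [← hWk]
      exact LinearEquiv.finrank_map_eq e W
  · rintro _ ⟨W, hW, rfl⟩
    refine hk.2 ⟨W.map e.symm.toLinearMap, ?_, LinearEquiv.finrank_map_eq e.symm W⟩
    rintro _ ⟨w, hw, rfl⟩
    rw [← he]
    simpa using hW w hw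

omit [FiniteDimensional F V] in
theorem HasType.of_equiv {t : FormType} (ht : HasType β t) (e : V ≃ₗ[F] V')
    (he : ∀ u v, γ (e u) (e v) = β u v) : HasType γ t := by
  have hdet : ∀ {n : ℕ} (b : Basis (Fin n) F V), gramDet γ (b.map e) = gramDet β b := by
    intro n b
    simp [gramDet, he]
  cases t with
  | plus =>
    obtain ⟨k, hk, hw⟩ := ht
    exact ⟨k, by rw [← e.finrank_eq, hk], hw.of_equiv e he⟩
  | minus =>
    obtain ⟨k, hk, hw⟩ := ht
    exact ⟨k, by rw [← e.finrank_eq, hk], hw.of_equiv e he⟩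
  | oddSquare =>
    obtain ⟨k, b, hb⟩ := ht
    exact ⟨k, b.map e, by rwa [hdet]⟩
  | oddNonsquare =>
    obtain ⟨k, b, hb⟩ := ht
    exact ⟨k, b.map e, by rwa [hdet]⟩

/-- Nondegenerate symmetric forms of the same dimension and type are isometric. -/
theorem SameType.isometric [Finite F] [FiniteDimensional F V'] (ht : SameType β γ)
    (h : IsSymmPairing fun u v => β u v) (h' : IsSymmPairing fun u v => γ u v)
    (hβ : NondegRight fun u v => β u v) (hγ : NondegRight fun u v => γ u v) (h2 : (2 : F) ≠ 0)
    (hdim : finrank F V = finrank F V') :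
    Isometric F (fun u v => β u v) (fun u v => γ u v) := by
  obtain ⟨t, ht, ht'⟩ := ht
  -- In odd dimension, two discriminants of the same class differ by a square factor.
  have hodd : ∀ {k k' : ℕ} (b : Basis (Fin (2 * k + 1)) F V) (b' : Basis (Fin (2 * k' + 1)) F V'),
      (IsSquare (gramDet β b) ↔ IsSquare (gramDet γ b')) →
      Isometric F (fun u v => β u v) (fun u v => γ u v) := by
    intro k k' b b' hsq
    have hk : k = k' := by
      have h1 : finrank F V = 2 * k + 1 := by simpa using finrank_eq_card_basis b
      have h3 : finrank F V' = 2 * k' + 1 := by simpa using finrank_eq_card_basis b'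
      omega
    subst hk
    obtain ⟨s, hs⟩ := exists_sq_mul_eq_of_isSquare_iff (h.det_gramMatrix_ne_zero hβ b)
      (h'.det_gramMatrix_ne_zero hγ b') hsq
    exact IsSymmPairing.isometric_of_det_eq h2 _ h h' hβ hγ b b' hs
  cases t with
  | plus =>
    obtain ⟨k, hk, hw⟩ := ht
    obtain ⟨k', hk', hw'⟩ := ht'
    obtain rfl : k = k' := by omega
    exact IsSymmPairing.isometric_of_isWittIndex h2 (Or.inl rfl) k h h' hβ hγ hk hk' hw hw'
  | minus =>
    obtain ⟨k, hk, hw⟩ := ht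
    obtain ⟨k', hk', hw'⟩ := ht'
    obtain rfl : k = k' := by omega
    exact IsSymmPairing.isometric_of_isWittIndex h2 (Or.inr rfl) k h h' hβ hγ hk hk' hw hw'
  | oddSquare =>
    obtain ⟨k, b, hb⟩ := ht
    obtain ⟨k', b', hb'⟩ := ht'
    exact hodd b b' ⟨fun _ => hb', fun _ => hb⟩
  | oddNonsquare =>
    obtain ⟨k, b, hb⟩ := ht
    obtain ⟨k', b', hb'⟩ := ht'
    exact hodd b b' ⟨fun h => absurd h hb, fun h => absurd h hb'⟩

end FormTypes

/-! ### Invariant forms as pairings over the group algebra -/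

section GroupAlgebra

open MonoidAlgebra

variable {F : Type*} [Field F] {G : Type*} [CommGroup G]

/-- The `σ`-semilinear involution of the group algebra that inverts the elements of the group. It
describes the adjoints with respect to an invariant sesquilinear form. -/
noncomputable def groupInvolution (G : Type*) [CommGroup G] (σ : F →+* F) :
    MonoidAlgebra F G →+* MonoidAlgebra F G :=
  (mapRingHom G σ).comp (mapDomainRingHom F (invMonoidHom : G →* G))

theorem groupInvolution_single (σ : F →+* F) (g : G) (c : F) :
    groupInvolution G σ (single g c) = single g⁻¹ (σ c) := by
  simp [groupInvolution]

theorem groupInvolution_involutive {σ : F →+* F} (hσ : Function.Involutive σ) :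
    Function.Involutive (groupInvolution G σ) := by
  intro r
  induction r using MonoidAlgebra.induction_linear with
  | zero => simp
  | add x y hx hy => rw [map_add, map_add, hx, hy]
  | single g c => rw [groupInvolution_single, groupInvolution_single, inv_inv, hσ]

variable {V : Type*} [AddCommGroup V] [Module (MonoidAlgebra F G) V]

theorem single_smul_inv_smul (g : G) (v : V) :
    (single g (1 : F) : MonoidAlgebra F G) • (single g⁻¹ (1 : F) : MonoidAlgebra F G) • v = v := by
  rw [smul_smul, single_mul_single, mul_inv_cancel, one_mul, ← one_def, one_smul]

variable [Module F V] [IsScalarTower F (MonoidAlgebra F G) V] {σ : F →+* F} {ε : F}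

theorem single_smul_eq (g : G) (c : F) (v : V) :
    (single g c : MonoidAlgebra F G) • v = c • (single g (1 : F) : MonoidAlgebra F G) • v := by
  rw [← smul_assoc, smul_single, smul_eq_mul, mul_one]

/-- An invariant sesquilinear form is a hermitian pairing over the group algebra. -/
theorem isHermitianPairing_of_invariant (β : V →ₗ[F] V →ₛₗ[σ] F) (hσ : Function.Involutive σ)
    (hε : ∀ u v, β v u = ε * σ (β u v))
    (hinv : ∀ (g : G) u v, β ((single g (1 : F) : MonoidAlgebra F G) • u)
      ((single g (1 : F) : MonoidAlgebra F G) • v) = β u v) :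
    IsHermitianPairing (groupInvolution G σ) σ ε fun u v => β u v := by
  have hadj : ∀ (r : MonoidAlgebra F G) u v, β (r • u) v = β u (groupInvolution G σ r • v) := by
    intro r u v
    induction r using MonoidAlgebra.induction_linear with
    | zero => simp
    | add x y hx hy =>
      rw [add_smul, map_add β, LinearMap.add_apply, hx, hy, map_add (groupInvolution G σ),
        add_smul, map_add]
    | single g c =>
      rw [groupInvolution_single, single_smul_eq, single_smul_eq g⁻¹, map_smul,
        LinearMap.smul_apply, LinearMap.map_smulₛₗ, hσ, smul_eq_mul, smul_eq_mul,
        ← hinv g u, single_smul_inv_smul]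
  exact
    { add_left := fun a b m => by rw [map_add, LinearMap.add_apply]
      add_right := fun a m n => map_add _ _ _
      smul_left := fun c a m => by rw [map_smul, LinearMap.smul_apply, smul_eq_mul]
      adj_left := hadj
      adj_right := fun r a m => by rw [hadj, groupInvolution_involutive hσ]
      symm := hε }

/-! ### Isotropy of the vectors on which the involution is trivial -/

theorem fixedIsotropic_of_map_ne {B : V → V → F} (hB : ∀ v, B 0 v = 0) (hσ : ∃ a, σ a ≠ a) :
    FixedIsotropic (groupInvolution G σ) B := by
  obtain ⟨a, ha⟩ := hσ
  intro v hv r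
  have h1 := hv (single 1 a)
  rw [groupInvolution_single, inv_one, single_smul_eq, single_smul_eq 1 a, ← one_def, one_smul,
    ← sub_eq_zero, ← sub_smul, smul_eq_zero_iff_right (sub_ne_zero.mpr ha)] at h1
  rw [h1, smul_zero, hB]

/-- For an alternating form, a vector `v` with `g² v = v` satisfies `B (g v) v = 0`: twice this
value vanishes, and in characteristic two `g` has odd order, so that `g v = v`. -/
theorem fixedIsotropic_of_alternating [Finite G] [NeZero (Nat.card G : F)] {B : V → V → F}
    (h : IsAdjointPairing (groupInvolution G σ) B) (halt : ∀ v, B v v = 0) :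
    FixedIsotropic (groupInvolution G σ) B := by
  intro v hv r
  induction r using MonoidAlgebra.induction_linear with
  | zero => rw [zero_smul, h.zero_left]
  | add x y hx hy => rw [add_smul, h.add_left, hx, hy, add_zero]
  | single g c =>
    rw [single_smul_eq, h.smul_left]
    suffices hg : B ((single g (1 : F) : MonoidAlgebra F G) • v) v = 0 by rw [hg, mul_zero]
    have hinv := hv (single g 1)
    have hadj := h.adj_left (single g 1) v v
    rw [hinv] at hadj
    have hanti := halt ((single g (1 : F) : MonoidAlgebra F G) • v + v)
    rw [h.add_left, h.add_right, h.add_right, halt, halt, ← hadj] at hanti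
    by_cases h2 : (2 : F) = 0
    · have hodd : Odd (Nat.card G) := by
        rw [← Nat.not_even_iff_odd]
        rintro ⟨k, hk⟩
        refine NeZero.ne (Nat.card G : F) ?_
        rw [hk, Nat.cast_add, ← two_mul, h2, zero_mul]
      obtain ⟨k, hk⟩ := hodd
      have hsq : (single g (1 : F) : MonoidAlgebra F G) •
          (single g (1 : F) : MonoidAlgebra F G) • v = v := by
        rw [groupInvolution_single, map_one] at hinv
        rw [← hinv, single_smul_inv_smul]
      have heven : ∀ n : ℕ, (single g (1 : F) : MonoidAlgebra F G) ^ (2 * n) • v = v := by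
        intro n
        induction n with
        | zero => simp
        | succ n ih => rw [mul_add, pow_add, mul_smul, mul_one, pow_two, mul_smul, hsq, ih]
      have hone : (single g (1 : F) : MonoidAlgebra F G) ^ (2 * k + 1) = 1 := by
        rw [← hk, single_pow, pow_card_eq_one', one_pow, one_def]
      have hgv : (single g (1 : F) : MonoidAlgebra F G) • v = v := by
        conv_rhs => rw [← one_smul (MonoidAlgebra F G) v, ← hone, pow_succ', mul_smul, heven]
      rw [hgv, halt]
    · refine (mul_eq_zero.mp (?_ : (2 : F) * _ = 0)).resolve_left h2
      linear_combination hanti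

/-! ### The eigenspaces of a generator for the eigenvalues `1` and `-1` -/

variable (V) in
/-- The eigenspace for `a` of the group element `g`, as a submodule over the group algebra. -/
noncomputable def eigenSubmodule (g : G) (a : F) : Submodule (MonoidAlgebra F G) V :=
  LinearMap.ker (LinearMap.lsmul (MonoidAlgebra F G) V
    (single g 1 - algebraMap F (MonoidAlgebra F G) a))

theorem mem_eigenSubmodule {g : G} {a : F} {v : V} : v ∈ eigenSubmodule V g a ↔
    (single g (1 : F) : MonoidAlgebra F G) • v = a • v := by
  rw [eigenSubmodule, LinearMap.mem_ker, LinearMap.lsmul_apply, sub_smul, algebraMap_smul,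
    sub_eq_zero]

theorem single_pow_smul_of_mem_eigenSubmodule {g : G} {a : F} {v : V}
    (hv : v ∈ eigenSubmodule V g a) (n : ℕ) (c : F) :
    (single (g ^ n) c : MonoidAlgebra F G) • v = (c * a ^ n) • v := by
  rw [single_smul_eq, mul_smul]
  congr 1
  rw [← one_pow n, ← single_pow]
  induction n with
  | zero => simp
  | succ n ih =>
    have hav : a ^ n • v ∈ eigenSubmodule V g a := by
      rw [← algebraMap_smul (MonoidAlgebra F G)]
      exact Submodule.smul_mem _ _ hv
    rw [pow_succ', mul_smul, ih, mem_eigenSubmodule.mp hav, smul_smul, ← pow_succ']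

/-- Isometric eigenspaces of a generator are isometric over the group algebra, which acts on them
through scalars. -/
theorem isometric_eigenSubmodule [Finite G] {V' : Type*} [AddCommGroup V'] [Module F V']
    [Module (MonoidAlgebra F G) V'] [IsScalarTower F (MonoidAlgebra F G) V'] {g : G}
    (hg : ∀ x, x ∈ Subgroup.zpowers g) {a : F} {B : V → V → F} {B' : V' → V' → F}
    {E : Submodule F V} {E' : Submodule F V'} (hE : ∀ v, v ∈ E ↔ v ∈ eigenSubmodule V g a)
    (hE' : ∀ v, v ∈ E' ↔ v ∈ eigenSubmodule V' g a)
    (hiso : Isometric F (restrictForm B E) (restrictForm B' E')) :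
    Isometric (MonoidAlgebra F G) (restrictForm B (eigenSubmodule V g a))
      (restrictForm B' (eigenSubmodule V' g a)) := by
  obtain ⟨e, he⟩ := hiso
  have hscalar : ∀ r : MonoidAlgebra F G, ∃ c : F, (∀ v ∈ eigenSubmodule V g a, r • v = c • v) ∧
      ∀ v ∈ eigenSubmodule V' g a, r • v = c • v := by
    intro r
    induction r using MonoidAlgebra.induction_linear with
    | zero => exact ⟨0, fun v _ => by simp, fun v _ => by simp⟩
    | add x y hx hy =>
      obtain ⟨c, hc, hc'⟩ := hx
      obtain ⟨d, hd, hd'⟩ := hy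
      exact ⟨c + d, fun v hv => by rw [add_smul, add_smul, hc v hv, hd v hv],
        fun v hv => by rw [add_smul, add_smul, hc' v hv, hd' v hv]⟩
    | single x c =>
      obtain ⟨n, rfl⟩ := (mem_powers_iff_mem_zpowers (x := g)).mpr (hg x)
      exact ⟨c * a ^ n, fun v hv => single_pow_smul_of_mem_eigenSubmodule hv n c,
        fun v hv => single_pow_smul_of_mem_eigenSubmodule hv n c⟩
  have hmem : ∀ v : eigenSubmodule V g a, (v : V) ∈ E := fun v => (hE v).mpr v.2
  have hmem' : ∀ v : eigenSubmodule V' g a, (v : V') ∈ E' := fun v => (hE' v).mpr v.2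
  refine ⟨
    { toFun := fun v => ⟨e ⟨v, hmem v⟩, (hE' _).mp (e ⟨v, hmem v⟩).2⟩
      invFun := fun v => ⟨e.symm ⟨v, hmem' v⟩, (hE _).mp (e.symm ⟨v, hmem' v⟩).2⟩
      left_inv := fun v => Subtype.ext (by simp)
      right_inv := fun v => Subtype.ext (by simp)
      map_add' := fun u v => Subtype.ext (by
        have := congrArg Subtype.val (map_add e ⟨u, hmem u⟩ ⟨v, hmem v⟩)
        exact this)
      map_smul' := fun r v => Subtype.ext ?_ }, fun u v => he ⟨u, hmem u⟩ ⟨v, hmem v⟩⟩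
  obtain ⟨c, hc, hc'⟩ := hscalar r
  have h1 : (⟨(r • v : eigenSubmodule V g a), hmem (r • v)⟩ : E) = c • ⟨v, hmem v⟩ :=
    Subtype.ext (hc v v.2)
  change ((e ⟨(r • v : eigenSubmodule V g a), hmem (r • v)⟩ : E') : V') = r • _
  rw [h1, map_smul, hc' _ ((hE' _).mp (e ⟨v, hmem v⟩).2)]
  rfl

/-- The eigenspaces for the eigenvalues `1` and `-1` are orthogonal. -/
theorem IsHermitianPairing.apply_eigenSubmodule {B : V → V → F}
    (h : IsHermitianPairing (groupInvolution G σ) σ ε B) (h2 : (2 : F) ≠ 0) {g : G}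
    (u : eigenSubmodule V g (1 : F)) (v : eigenSubmodule V g (-1 : F)) : B u v = 0 := by
  have h1 := h.adj_left (single g 1) u ((single g (1 : F) : MonoidAlgebra F G) • (v : V))
  have hu := mem_eigenSubmodule.mp u.2
  have hv := mem_eigenSubmodule.mp v.2
  rw [groupInvolution_single, map_one] at h1
  have h3 := single_smul_inv_smul (F := F) g⁻¹ (v : V)
  rw [inv_inv] at h3
  rw [h3, hu, hv, one_smul, neg_one_smul, h.neg_right] at h1
  exact (mul_eq_zero.mp (by linear_combination -h1 : (2 : F) * B u v = 0)).resolve_left h2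

theorem IsHermitianPairing.apply_eigenSubmodule' {B : V → V → F}
    (h : IsHermitianPairing (groupInvolution G σ) σ ε B) (h2 : (2 : F) ≠ 0) {g : G}
    (u : eigenSubmodule V g (1 : F)) (v : eigenSubmodule V g (-1 : F)) : B v u = 0 :=
  h.eq_zero_comm (h.apply_eigenSubmodule h2 u v)

/-- The adjoint involution fixes no nonzero vector in the complement of a nondegenerate module
that contains the eigenspaces for `1` and `-1`: a vector `v` with `g² v = v` yields the
eigenvectors `g v + v` and, once this is zero, `v` itself. -/
theorem IsHermitianPairing.fixedIsotropic_orth {B : V → V → F}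
    (h : IsHermitianPairing (groupInvolution G σ) σ ε B) {N : Type*} [AddCommGroup N]
    [Module (MonoidAlgebra F G) N] (j : N →ₗ[MonoidAlgebra F G] V)
    (hj : NondegRight fun p q => B (j p) (j q)) {g : G}
    (h1 : ∀ v ∈ eigenSubmodule V g (1 : F), v ∈ LinearMap.range j)
    (h3 : ∀ v ∈ eigenSubmodule V g (-1 : F), v ∈ LinearMap.range j) :
    FixedIsotropic (groupInvolution G σ) (restrictForm B (h.orth (LinearMap.range j))) := by
  intro v hv r
  have hzero : ∀ z ∈ h.orth (LinearMap.range j), z ∈ LinearMap.range j → z = 0 := by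
    rintro _ hz ⟨p, rfl⟩
    rw [hj p fun q => h.mem_orth_range.mp hz q, map_zero]
  have hsq : (single g (1 : F) : MonoidAlgebra F G) •
      (single g (1 : F) : MonoidAlgebra F G) • (v : V) = v := by
    have h4 := congrArg Subtype.val (hv (single g 1))
    rw [groupInvolution_single, map_one, Submodule.coe_smul, Submodule.coe_smul] at h4
    rw [← h4, single_smul_inv_smul]
  have hplus : (single g (1 : F) : MonoidAlgebra F G) • (v : V) + v = 0 := by
    refine hzero _ (add_mem (Submodule.smul_mem _ _ v.2) v.2) (h1 _ ?_)
    rw [mem_eigenSubmodule, smul_add, hsq, one_smul, add_comm]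
  have hv0 : v = 0 := by
    refine Subtype.ext (hzero _ v.2 (h3 _ ?_))
    rw [mem_eigenSubmodule, neg_one_smul]
    exact eq_neg_of_add_eq_zero_left hplus
  rw [hv0, smul_zero]
  exact h.zero_left 0

universe u

/-- Symmetric forms with isometric eigenspaces for `1` and `-1` are isometric: on the complement
of these eigenspaces, the adjoint involution fixes no nonzero vector. -/
theorem isometric_of_isometric_eigenSubmodules [Finite F] [Finite G] [NeZero (Nat.card G : F)]
    {V V' : Type u} [AddCommGroup V] [Module F V] [Module (MonoidAlgebra F G) V]
    [IsScalarTower F (MonoidAlgebra F G) V] [FiniteDimensional F V]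
    [AddCommGroup V'] [Module F V'] [Module (MonoidAlgebra F G) V']
    [IsScalarTower F (MonoidAlgebra F G) V'] [FiniteDimensional F V'] (h2 : (2 : F) ≠ 0)
    (hσ : Function.Involutive σ) {B : V → V → F} {B' : V' → V' → F}
    (h : IsHermitianPairing (groupInvolution G σ) σ ε B)
    (h' : IsHermitianPairing (groupInvolution G σ) σ ε B')
    (hB : NondegRight B) (hB' : NondegRight B') (hc : SameHomCount (MonoidAlgebra F G) V V') (g : G)
    (hn₁ : NondegRight (restrictForm B (eigenSubmodule V g (1 : F))))
    (hn₂ : NondegRight (restrictForm B (eigenSubmodule V g (-1 : F))))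
    (hiso₁ : Isometric (MonoidAlgebra F G) (restrictForm B (eigenSubmodule V g (1 : F)))
      (restrictForm B' (eigenSubmodule V' g (1 : F))))
    (hiso₂ : Isometric (MonoidAlgebra F G) (restrictForm B (eigenSubmodule V g (-1 : F)))
      (restrictForm B' (eigenSubmodule V' g (-1 : F)))) :
    Isometric (MonoidAlgebra F G) B B' := by
  obtain ⟨e₁, he₁⟩ := hiso₁
  obtain ⟨e₂, he₂⟩ := hiso₂
  let j := (eigenSubmodule V g (1 : F)).subtype.coprod (eigenSubmodule V g (-1 : F)).subtype
  let j' := ((eigenSubmodule V' g (1 : F)).subtype ∘ₗ e₁.toLinearMap).coprod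
    ((eigenSubmodule V' g (-1 : F)).subtype ∘ₗ e₂.toLinearMap)
  have hj : ∀ p q, B (j p) (j q) = B p.1 q.1 + B p.2 q.2 := by
    intro p q
    simp only [j, LinearMap.coprod_apply, Submodule.subtype_apply, h.add_left, h.add_right,
      h.apply_eigenSubmodule h2, h.apply_eigenSubmodule' h2]
    ring
  have hj' : ∀ p q, B' (j' p) (j' q) = B p.1 q.1 + B p.2 q.2 := by
    intro p q
    have h1 : B' (e₁ p.1) (e₁ q.1) = B p.1 q.1 := he₁ p.1 q.1
    have h3 : B' (e₂ p.2) (e₂ q.2) = B p.2 q.2 := he₂ p.2 q.2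
    simp only [j', LinearMap.coprod_apply, LinearMap.comp_apply, Submodule.subtype_apply,
      LinearEquiv.coe_coe, h'.add_left, h'.add_right, h'.apply_eigenSubmodule h2,
      h'.apply_eigenSubmodule' h2, h1, h3]
    ring
  have hnd : NondegRight fun p q => B (j p) (j q) := by
    intro p hp
    simp only [hj] at hp
    refine Prod.ext (hn₁ _ fun u => ?_) (hn₂ _ fun u => ?_)
    · simpa [h.zero_left, restrictForm] using hp (u, 0)
    · simpa [h.zero_left, restrictForm] using hp (0, u)
  have hjj' : ∀ p q, B' (j' p) (j' q) = B (j p) (j q) := fun p q => by rw [hj, hj']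
  have hnd' : NondegRight fun p q => B' (j' p) (j' q) := by simpa only [hjj'] using hnd
  have := Module.finite_of_finite F (M := V)
  have := Module.finite_of_finite F (M := V')
  refine Isometric.of_orth h h' j j' hnd hjj' (isometric_of_sameHomCount
    (groupInvolution_involutive hσ) (h.restrict _) (h'.restrict _) (h.nondegRight_orth hB j hnd)
    (h'.nondegRight_orth hB' j' hnd') (hc.cancel (h.splitEquiv j hnd) (h'.splitEquiv j' hnd'))
    (h.fixedIsotropic_orth j hnd (fun v hv => ⟨(⟨v, hv⟩, 0), by simp [j]⟩)
      (fun v hv => ⟨(0, ⟨v, hv⟩), by simp [j]⟩))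
    (h'.fixedIsotropic_orth j' hnd' (fun v hv => ⟨(e₁.symm ⟨v, hv⟩, 0), by simp [j']⟩)
      (fun v hv => ⟨(0, e₂.symm ⟨v, hv⟩), by simp [j']⟩)))

end GroupAlgebra

/-! ### Equivariant isometries -/

section Equivariant

open MonoidAlgebra

universe u

variable {F : Type*} [Field F] {σ : F →+* F} {ε : F}
  {V V' : Type u} [AddCommGroup V] [Module F V] [AddCommGroup V'] [Module F V']
  {β : V →ₗ[F] V →ₛₗ[σ] F} {β' : V' →ₗ[F] V' →ₛₗ[σ] F}

/-- A semisimple element has finite order, invertible in the field. -/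
theorem IsSemisimpleElement.orderOf_cast_ne_zero {X : V ≃ₗ[F] V} (hX : IsSemisimpleElement X) :
    (orderOf X : F) ≠ 0 := by
  intro h0
  rw [ringChar.spec] at h0
  have h1 : ringChar F = 1 := Nat.eq_one_of_dvd_coprimes hX h0 dvd_rfl
  exact CharP.ringChar_ne_one h1

/-- The module over the group algebra defined by a representation. -/
noncomputable abbrev groupAlgebraModule {G : Type*} [CommGroup G] (ρ : G →* (V ≃ₗ[F] V)) :
    Module (MonoidAlgebra F G) V :=
  Module.compHom V (MonoidAlgebra.lift F (Module.End F V) G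
    (LinearEquiv.automorphismGroup.toLinearMapMonoidHom.comp ρ)).toRingHom

/-- Two semisimple isometries that are conjugate by a linear isomorphism make the two spaces
isomorphic modules over the group algebra of a finite cyclic group of order invertible in the
field. An isometry over this algebra intertwines the two elements. -/
theorem exists_equivariant_isometry [Finite F] [FiniteDimensional F V] [FiniteDimensional F V']
    (hσ : Function.Involutive σ)
    (hε : ∀ u v, β v u = ε * σ (β u v)) (hε' : ∀ u v, β' v u = ε * σ (β' u v))
    (X : isometryGroup β) (X' : isometryGroup β')
    (hX : IsSemisimpleElement (X : V ≃ₗ[F] V)) (hX' : IsSemisimpleElement (X' : V' ≃ₗ[F] V'))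
    (φ : V ≃ₗ[F] V') (hφ : ∀ v, φ ((X : V ≃ₗ[F] V) v) = (X' : V' ≃ₗ[F] V') (φ v))
    (H : ∀ (G : Type u) [CommGroup G] [Finite G] [NeZero (Nat.card G : F)]
      [Module (MonoidAlgebra F G) V] [IsScalarTower F (MonoidAlgebra F G) V]
      [Module (MonoidAlgebra F G) V'] [IsScalarTower F (MonoidAlgebra F G) V'] (g : G),
      (∀ x, x ∈ Subgroup.zpowers g) →
      (∀ v : V, (single g (1 : F) : MonoidAlgebra F G) • v = (X : V ≃ₗ[F] V) v) →
      (∀ v : V', (single g (1 : F) : MonoidAlgebra F G) • v = (X' : V' ≃ₗ[F] V') v) →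
      IsHermitianPairing (groupInvolution G σ) σ ε (fun u v => β u v) →
      IsHermitianPairing (groupInvolution G σ) σ ε (fun u v => β' u v) →
      SameHomCount (MonoidAlgebra F G) V V' →
      Isometric (MonoidAlgebra F G) (fun u v => β u v) (fun u v => β' u v)) :
    ∃ ψ : V ≃ₗ[F] V', (∀ v, ψ ((X : V ≃ₗ[F] V) v) = (X' : V' ≃ₗ[F] V') (ψ v)) ∧
      ∀ u v, β' (ψ u) (ψ v) = β u v := by
  let p : (V ≃ₗ[F] V) × (V' ≃ₗ[F] V') := (X, X')
  let G := Subgroup.zpowers p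
  have : Finite V := Module.finite_of_finite F
  have : Finite V' := Module.finite_of_finite F
  have : Finite (V ≃ₗ[F] V) := Finite.of_injective _ DFunLike.coe_injective
  have : Finite (V' ≃ₗ[F] V') := Finite.of_injective _ DFunLike.coe_injective
  let : CommGroup G := IsCyclic.commGroup
  have : NeZero (Nat.card G : F) := by
    refine ⟨fun h0 => ?_⟩
    rw [Nat.card_zpowers, Prod.orderOf] at h0
    have h1 : ((orderOf (X : V ≃ₗ[F] V) * orderOf (X' : V' ≃ₗ[F] V') : ℕ) : F) = 0 := by
      obtain ⟨k, hk⟩ := Nat.lcm_dvd_mul (orderOf (X : V ≃ₗ[F] V)) (orderOf (X' : V' ≃ₗ[F] V'))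
      rw [hk, Nat.cast_mul, h0, zero_mul]
    rw [Nat.cast_mul, mul_eq_zero] at h1
    exact h1.elim hX.orderOf_cast_ne_zero hX'.orderOf_cast_ne_zero
  let ρ : G →* (V ≃ₗ[F] V) := (MonoidHom.fst _ _).comp G.subtype
  let ρ' : G →* (V' ≃ₗ[F] V') := (MonoidHom.snd _ _).comp G.subtype
  let : Module (MonoidAlgebra F G) V := groupAlgebraModule ρ
  let : Module (MonoidAlgebra F G) V' := groupAlgebraModule ρ'
  have hact : ∀ (x : G) (c : F) (v : V), (single x c : MonoidAlgebra F G) • v = c • ρ x v := by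
    intro x c v
    change (MonoidAlgebra.lift F (Module.End F V) G _ (single x c)) v = _
    rw [MonoidAlgebra.lift_single]
    rfl
  have hact' : ∀ (x : G) (c : F) (v : V'), (single x c : MonoidAlgebra F G) • v = c • ρ' x v := by
    intro x c v
    change (MonoidAlgebra.lift F (Module.End F V') G _ (single x c)) v = _
    rw [MonoidAlgebra.lift_single]
    rfl
  have : IsScalarTower F (MonoidAlgebra F G) V := ⟨fun c r v => by
    change (MonoidAlgebra.lift F (Module.End F V) G _ (c • r)) v = _
    rw [map_smul]
    rfl⟩
  have : IsScalarTower F (MonoidAlgebra F G) V' := ⟨fun c r v => by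
    change (MonoidAlgebra.lift F (Module.End F V') G _ (c • r)) v = _
    rw [map_smul]
    rfl⟩
  let g : G := ⟨p, Subgroup.mem_zpowers p⟩
  have hg : ∀ x : G, x ∈ Subgroup.zpowers g := by
    rintro ⟨x, n, rfl⟩
    exact ⟨n, Subtype.ext rfl⟩
  have hinv : ∀ x : G, ρ x ∈ isometryGroup β := fun x =>
    Subgroup.zpowers_le.mpr (show p ∈ (isometryGroup β).comap (MonoidHom.fst _ _) from X.2) x.2
  have hinv' : ∀ x : G, ρ' x ∈ isometryGroup β' := fun x =>
    Subgroup.zpowers_le.mpr (show p ∈ (isometryGroup β').comap (MonoidHom.snd _ _) from X'.2) x.2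
  have hφpow : ∀ (x : G) (v : V), φ (ρ x v) = ρ' x (φ v) := by
    intro x
    obtain ⟨n, rfl⟩ := (mem_powers_iff_mem_zpowers (x := g)).mpr (hg x)
    induction n with
    | zero => intro v; simp
    | succ n ih =>
      intro v
      simp only [pow_succ, map_mul, LinearEquiv.mul_apply] at ih ⊢
      rw [ih]
      exact congrArg _ (hφ v)
  let φR : V ≃ₗ[MonoidAlgebra F G] V' :=
    { φ.toAddEquiv with
      map_smul' := fun r v => by
        change φ (r • v) = r • φ v
        induction r using MonoidAlgebra.induction_linear with
        | zero => simp
        | add x y hx hy => rw [add_smul, map_add, hx, hy, add_smul]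
        | single x c => rw [hact, hact', map_smul, hφpow] }
  obtain ⟨ψ, hψ⟩ := H G g hg (fun v => by rw [hact, one_smul]; rfl)
    (fun v => by rw [hact', one_smul]; rfl)
    (isHermitianPairing_of_invariant β hσ hε fun x u v => by
      rw [hact, hact, one_smul, one_smul]; exact hinv x u v)
    (isHermitianPairing_of_invariant β' hσ hε' fun x u v => by
      rw [hact', hact', one_smul, one_smul]; exact hinv' x u v)
    (SameHomCount.of_equiv φR)
  refine ⟨ψ.restrictScalars F, fun v => ?_, hψ⟩
  have := map_smul ψ (single g (1 : F) : MonoidAlgebra F G) v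
  rw [hact, hact', one_smul, one_smul] at this
  exact this

end Equivariant

/-! ### Eigenspaces of isometries of symmetric forms -/

section Eigenspaces

open MonoidAlgebra Module

variable {F : Type*} [Field F] {σ : F →+* F} {V : Type*} [AddCommGroup V] [Module F V]
  {β : V →ₗ[F] V →ₛₗ[σ] F}

theorem IsSymmetric.isSymmPairing (hβ : IsSymmetric β) : IsSymmPairing fun u v => β u v where
  add_left a b m := by rw [map_add, LinearMap.add_apply]
  add_right a m n := map_add _ _ _
  smul_left c a m := by rw [map_smul, LinearMap.smul_apply, smul_eq_mul]
  adj_left r a m := by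
    rw [map_smul β, LinearMap.smul_apply, LinearMap.map_smulₛₗ, hβ.1]
    rfl
  adj_right r a m := by
    rw [map_smul β, LinearMap.smul_apply, LinearMap.map_smulₛₗ, hβ.1]
    rfl
  symm u v := by rw [one_mul, RingHom.id_apply, hβ.2]

theorem IsSymmetric.eigenspaceForm (hβ : IsSymmetric β) (X : V ≃ₗ[F] V) (a : F) :
    IsSymmetric (eigenspaceForm β X a) :=
  ⟨hβ.1, fun u v => hβ.2 u v⟩

/-- The eigenspaces for `1` and `-1` of a semisimple isometry are nondegenerate: averaging over
the powers of `a X` projects `V` to the eigenspace for `a` and preserves the values of the form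
against vectors of this eigenspace. -/
theorem nondegRight_eigenspaceForm (hβ : NondegRight fun u v => β u v) (h2 : (2 : F) ≠ 0)
    (X : isometryGroup β) (hX : IsSemisimpleElement (X : V ≃ₗ[F] V)) {a : F} (ha : a * a = 1)
    (hσ : ∀ a, σ a = a) :
    NondegRight fun u v => eigenspaceForm β (X : V ≃ₗ[F] V) a u v := by
  rintro ⟨v, hv⟩ hall
  refine Subtype.ext (hβ v fun u => ?_)
  let Y : Module.End F V := a • ((X : V ≃ₗ[F] V) : Module.End F V)
  let M := 2 * orderOf (X : V ≃ₗ[F] V)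
  have hM : (M : F) ≠ 0 := by
    rw [Nat.cast_mul, Nat.cast_ofNat]
    exact mul_ne_zero h2 hX.orderOf_cast_ne_zero
  have hYM : Y ^ M = 1 := by
    have h1 : ((X : V ≃ₗ[F] V) : Module.End F V) ^ M = 1 := by
      have h3 := map_pow (LinearEquiv.automorphismGroup.toLinearMapMonoidHom (R := F) (M := V))
        (X : V ≃ₗ[F] V) M
      rw [pow_mul', pow_orderOf_eq_one, one_pow, map_one] at h3
      exact h3.symm
    rw [smul_pow, h1, pow_mul, pow_two, ha, one_pow, one_smul]
  have hXv : (X : V ≃ₗ[F] V) v = a • v := Module.End.mem_eigenspace_iff.mp hv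
  have hYv : Y v = v := by
    change a • (X : V ≃ₗ[F] V) v = v
    rw [hXv, smul_smul, ha, one_smul]
  have hYinv : ∀ w, β (Y w) v = β w v := by
    intro w
    conv_lhs => rw [← hYv]
    change β (a • (X : V ≃ₗ[F] V) w) (a • (X : V ≃ₗ[F] V) v) = β w v
    rw [map_smul β, LinearMap.smul_apply, LinearMap.map_smulₛₗ, hσ, smul_smul, ha, one_smul]
    exact X.2 w v
  have hpow : ∀ i : ℕ, β ((Y ^ i) u) v = β u v := by
    intro i
    induction i with
    | zero => rw [pow_zero, Module.End.one_apply]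
    | succ i ih => rw [pow_succ', Module.End.mul_apply, hYinv, ih]
  let s : V := (∑ i ∈ Finset.range M, Y ^ i) u
  have hYs : Y s = s := by
    have h1 := mul_geom_sum Y M
    rw [hYM, sub_self] at h1
    have h3 := LinearMap.congr_fun h1 u
    rw [Module.End.mul_apply, LinearMap.sub_apply, LinearMap.zero_apply, Module.End.one_apply]
      at h3
    exact sub_eq_zero.mp h3
  have hs : s ∈ Module.End.eigenspace ((X : V ≃ₗ[F] V) : Module.End F V) a := by
    rw [Module.End.mem_eigenspace_iff]
    conv_rhs => rw [← hYs]
    change _ = a • a • (X : V ≃ₗ[F] V) s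
    rw [smul_smul, ha, one_smul]
    rfl
  have hsv : β s v = 0 := hall ⟨s, hs⟩
  have hsum : β s v = M * β u v := by
    simp only [s, LinearMap.sum_apply, map_sum, hpow, Finset.sum_const, Finset.card_range,
      nsmul_eq_mul]
  rw [hsum] at hsv
  exact (mul_eq_zero.mp hsv).resolve_left hM

/-- A linear isomorphism intertwining two elements restricts to their eigenspaces. -/
noncomputable def eigenspaceEquiv {X X' ψ : V ≃ₗ[F] V} (hψ : ∀ v, ψ (X v) = X' (ψ v)) (a : F) :
    Module.End.eigenspace (X : Module.End F V) a ≃ₗ[F]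
      Module.End.eigenspace (X' : Module.End F V) a :=
  LinearEquiv.ofSubmodules ψ _ _ (by
    ext w
    simp only [Submodule.mem_map, Module.End.mem_eigenspace_iff, LinearEquiv.coe_coe]
    constructor
    · rintro ⟨v, hv, rfl⟩
      rw [← hψ, hv, map_smul]
    · intro hw
      refine ⟨ψ.symm w, ψ.injective ?_, ψ.apply_symm_apply w⟩
      rw [hψ, map_smul, ψ.apply_symm_apply, hw])

/-- Conjugate semisimple isometries have eigenspaces of the same type. -/
theorem sameType_eigenspaceForm [Finite F] [FiniteDimensional F V] (hβ : IsSymmetric β)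
    (hnd : NondegRight fun u v => β u v) (h2 : (2 : F) ≠ 0) {X₁ X₂ : isometryGroup β}
    (hX₁ : IsSemisimpleElement (X₁ : V ≃ₗ[F] V)) (hconj : IsConj X₁ X₂) {a : F} (ha : a * a = 1) :
    SameType (eigenspaceForm β (X₁ : V ≃ₗ[F] V) a) (eigenspaceForm β (X₂ : V ≃ₗ[F] V) a) := by
  obtain ⟨c, rfl⟩ := isConj_iff.mp hconj
  have hψ : ∀ v, (c : V ≃ₗ[F] V) ((X₁ : V ≃ₗ[F] V) v)
      = ((c * X₁ * c⁻¹ : isometryGroup β) : V ≃ₗ[F] V) ((c : V ≃ₗ[F] V) v) := by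
    intro v
    rw [← LinearEquiv.mul_apply, ← LinearEquiv.mul_apply, ← Subgroup.coe_mul, ← Subgroup.coe_mul,
      inv_mul_cancel_right]
  obtain ⟨t, ht⟩ := exists_hasType (hβ.eigenspaceForm (X₁ : V ≃ₗ[F] V) a).isSymmPairing
    (nondegRight_eigenspaceForm hnd h2 X₁ hX₁ ha hβ.1) h2
  exact ⟨t, ht, ht.of_equiv (eigenspaceEquiv hψ a) fun u v => c.2 u v⟩

end Eigenspaces

/-! ### Conjugacy in the isometry group -/

section Conjugacy

open MonoidAlgebra Module

universe u

variable {F : Type*} [Field F] [Finite F] {σ : F →+* F} {ε : F} {V V' : Type u}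
  [AddCommGroup V] [Module F V] [FiniteDimensional F V] [AddCommGroup V'] [Module F V']
  [FiniteDimensional F V'] {β : V →ₗ[F] V →ₛₗ[σ] F} {β' : V' →ₗ[F] V' →ₛₗ[σ] F}

omit [Finite F] [FiniteDimensional F V] in
theorem exists_intertwining_of_isConj {X₁ X₂ : V ≃ₗ[F] V} (h : IsConj X₁ X₂) :
    ∃ φ : V ≃ₗ[F] V, ∀ v, φ (X₁ v) = X₂ (φ v) := by
  obtain ⟨c, rfl⟩ := isConj_iff.mp h
  exact ⟨c, fun v => by
    rw [← LinearEquiv.mul_apply, ← LinearEquiv.mul_apply, inv_mul_cancel_right]⟩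

omit [Finite F] [FiniteDimensional F V] in
theorem isConj_of_intertwining {X₁ X₂ : isometryGroup β} (ψ : V ≃ₗ[F] V)
    (hψ : ∀ v, ψ ((X₁ : V ≃ₗ[F] V) v) = (X₂ : V ≃ₗ[F] V) (ψ v))
    (hiso : ∀ u v, β (ψ u) (ψ v) = β u v) : IsConj X₁ X₂ := by
  refine isConj_iff.mpr ⟨⟨ψ, hiso⟩, ?_⟩
  rw [mul_inv_eq_iff_eq_mul]
  exact Subtype.ext (LinearEquiv.ext hψ)

/-- For hermitian forms with a nontrivial automorphism, and for alternating forms, linearly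
equivalent semisimple isometries are equivalent through an isometry. -/
theorem exists_isometry_of_intertwining (hσ : Function.Involutive σ)
    (hε : ∀ u v, β v u = ε * σ (β u v)) (hε' : ∀ u v, β' v u = ε * σ (β' u v))
    (hnd : NondegRight fun u v => β u v) (hnd' : NondegRight fun u v => β' u v)
    (hβ : (∃ a, σ a ≠ a) ∨ (∀ v, β v v = 0) ∧ ∀ v, β' v v = 0)
    (X : isometryGroup β) (X' : isometryGroup β')
    (hX : IsSemisimpleElement (X : V ≃ₗ[F] V)) (hX' : IsSemisimpleElement (X' : V' ≃ₗ[F] V'))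
    (φ : V ≃ₗ[F] V') (hφ : ∀ v, φ ((X : V ≃ₗ[F] V) v) = (X' : V' ≃ₗ[F] V') (φ v)) :
    ∃ ψ : V ≃ₗ[F] V', (∀ v, ψ ((X : V ≃ₗ[F] V) v) = (X' : V' ≃ₗ[F] V') (ψ v)) ∧
      ∀ u v, β' (ψ u) (ψ v) = β u v := by
  refine exists_equivariant_isometry hσ hε hε' X X' hX hX' φ hφ ?_
  intro G _ _ _ _ _ _ _ g _ _ _ h h' hc
  refine isometric_of_sameHomCount (groupInvolution_involutive hσ) h h' hnd hnd' hc ?_ ?_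
  · rcases hβ with hβ | hβ
    · exact fixedIsotropic_of_map_ne h.zero_left hβ
    · exact fixedIsotropic_of_alternating h.toIsAdjointPairing hβ.1
  · rcases hβ with hβ | hβ
    · exact fixedIsotropic_of_map_ne h'.zero_left hβ
    · exact fixedIsotropic_of_alternating h'.toIsAdjointPairing hβ.2

/-- For symmetric forms in odd characteristic, linearly equivalent semisimple isometries with
isometric eigenspaces for `1` and `-1` are equivalent through an isometry. -/
theorem IsSymmetric.exists_isometry_of_intertwining (hβ : IsSymmetric β) (hβ' : IsSymmetric β')
    (h2 : (2 : F) ≠ 0) (hnd : NondegRight fun u v => β u v)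
    (hnd' : NondegRight fun u v => β' u v) (X : isometryGroup β) (X' : isometryGroup β')
    (hX : IsSemisimpleElement (X : V ≃ₗ[F] V)) (hX' : IsSemisimpleElement (X' : V' ≃ₗ[F] V'))
    (φ : V ≃ₗ[F] V') (hφ : ∀ v, φ ((X : V ≃ₗ[F] V) v) = (X' : V' ≃ₗ[F] V') (φ v))
    (hiso : ∀ a : F, a = 1 ∨ a = -1 →
      Isometric F (fun u v => ClassicalForm.eigenspaceForm β (X : V ≃ₗ[F] V) a u v)
        (fun u v => ClassicalForm.eigenspaceForm β' (X' : V' ≃ₗ[F] V') a u v)) :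
    ∃ ψ : V ≃ₗ[F] V', (∀ v, ψ ((X : V ≃ₗ[F] V) v) = (X' : V' ≃ₗ[F] V') (ψ v)) ∧
      ∀ u v, β' (ψ u) (ψ v) = β u v := by
  have hσ : Function.Involutive σ := fun a => by rw [hβ.1, hβ.1]
  have hε : ∀ u v, β v u = 1 * σ (β u v) := fun u v => by rw [hβ.1, one_mul, hβ.2]
  have hε' : ∀ u v, β' v u = 1 * σ (β' u v) := fun u v => by rw [hβ.1, one_mul, hβ'.2]
  refine exists_equivariant_isometry hσ hε hε' X X' hX hX' φ hφ ?_
  intro G _ _ _ _ _ _ _ g hg hact hact' h h' hc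
  have hmem : ∀ (a : F) (v : V),
      v ∈ Module.End.eigenspace ((X : V ≃ₗ[F] V) : Module.End F V) a ↔
        v ∈ eigenSubmodule V g a := by
    intro a v
    rw [mem_eigenSubmodule, hact, Module.End.mem_eigenspace_iff]
    rfl
  have hmem' : ∀ (a : F) (v : V'),
      v ∈ Module.End.eigenspace ((X' : V' ≃ₗ[F] V') : Module.End F V') a ↔
        v ∈ eigenSubmodule V' g a := by
    intro a v
    rw [mem_eigenSubmodule, hact', Module.End.mem_eigenspace_iff]
    rfl
  have hn : ∀ a : F, a * a = 1 →
      NondegRight (restrictForm (fun u v => β u v) (eigenSubmodule V g a)) := by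
    intro a ha v hv
    have h1 := nondegRight_eigenspaceForm hnd h2 X hX ha hβ.1
      ⟨v, (hmem a v).mpr v.2⟩ fun u => hv ⟨u, (hmem a u).mp u.2⟩
    exact Subtype.ext (Subtype.mk_eq_mk.mp h1)
  exact isometric_of_isometric_eigenSubmodules h2 hσ h h' hnd hnd' hc g (hn 1 (one_mul 1))
    (hn (-1) (by ring))
    (isometric_eigenSubmodule hg (hmem 1) (hmem' 1) (hiso 1 (Or.inl rfl)))
    (isometric_eigenSubmodule hg (hmem (-1)) (hmem' (-1)) (hiso (-1) (Or.inr rfl)))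

end Conjugacy

end ClassicalForm

theorem mainTheorem2 {F : Type*} [Field F] [Finite F] (q : ℕ)
    (hF : Nat.card F = q ∨ Nat.card F = q ^ 2)
    (σ : F →+* F) (hσ : ∀ a, σ a = a ^ q)
    {V : Type*} [AddCommGroup V] [Module F V] [FiniteDimensional F V]
    (β : V →ₗ[F] V →ₛₗ[σ] F) (hrefl : β.IsRefl) (hnondeg : β.Nondegenerate)
    (X₁ X₂ : ClassicalForm.isometryGroup β)
    (hX₁ : ClassicalForm.IsSemisimpleElement (X₁ : V ≃ₗ[F] V))
    (hX₂ : ClassicalForm.IsSemisimpleElement (X₂ : V ≃ₗ[F] V)) :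
    (ClassicalForm.IsAlternating β →
      (IsConj X₁ X₂ ↔ IsConj (X₁ : V ≃ₗ[F] V) (X₂ : V ≃ₗ[F] V))) ∧
    (ClassicalForm.IsHermitian β →
      (IsConj X₁ X₂ ↔ IsConj (X₁ : V ≃ₗ[F] V) (X₂ : V ≃ₗ[F] V))) ∧
    (Odd q → ClassicalForm.IsSymmetric β →
      (IsConj X₁ X₂ ↔
        IsConj (X₁ : V ≃ₗ[F] V) (X₂ : V ≃ₗ[F] V) ∧
        ClassicalForm.SameType (ClassicalForm.eigenspaceForm β (X₁ : V ≃ₗ[F] V) 1)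
          (ClassicalForm.eigenspaceForm β (X₂ : V ≃ₗ[F] V) 1) ∧
        ClassicalForm.SameType (ClassicalForm.eigenspaceForm β (X₁ : V ≃ₗ[F] V) (-1))
          (ClassicalForm.eigenspaceForm β (X₂ : V ≃ₗ[F] V) (-1)))) := by
  have hnd : ClassicalForm.NondegRight fun u v => β u v := fun v hv => hnondeg.2 v hv
  have hmap : IsConj X₁ X₂ → IsConj (X₁ : V ≃ₗ[F] V) (X₂ : V ≃ₗ[F] V) := fun h =>
    (ClassicalForm.isometryGroup β).subtype.map_isConj h
  refine ⟨fun hβ => ⟨hmap, ?_⟩, fun hβ => ⟨hmap, ?_⟩, fun hq hβ => ⟨fun h => ?_, ?_⟩⟩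
  · intro hconj
    have hε : ∀ u v, β v u = -1 * σ (β u v) := by
      intro u v
      have h1 := hβ.2 (u + v)
      rw [map_add, map_add, LinearMap.add_apply, LinearMap.add_apply, hβ.2, hβ.2] at h1
      rw [hβ.1]
      linear_combination h1
    obtain ⟨φ, hφ⟩ := ClassicalForm.exists_intertwining_of_isConj hconj
    obtain ⟨ψ, hψ, hiso⟩ := ClassicalForm.exists_isometry_of_intertwining
      (fun a => by rw [hβ.1, hβ.1]) hε hε hnd hnd (Or.inr ⟨hβ.2, hβ.2⟩) X₁ X₂ hX₁ hX₂ φ hφ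
    exact ClassicalForm.isConj_of_intertwining ψ hψ hiso
  · intro hconj
    have hε : ∀ u v, β v u = 1 * σ (β u v) := fun u v => by rw [one_mul, hβ.2]
    obtain ⟨φ, hφ⟩ := ClassicalForm.exists_intertwining_of_isConj hconj
    obtain ⟨ψ, hψ, hiso⟩ := ClassicalForm.exists_isometry_of_intertwining
      hβ.1.1 hε hε hnd hnd (Or.inl hβ.1.2) X₁ X₂ hX₁ hX₂ φ hφ
    exact ClassicalForm.isConj_of_intertwining ψ hψ hiso
  all_goals
    have h2 : (2 : F) ≠ 0 := by
      intro h0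
      have hodd : Odd (Nat.card F) := by
        rcases hF with hF | hF
        · rwa [hF]
        · rw [hF]
          exact hq.pow
      have := Fintype.ofFinite F
      have hchar : ringChar F = 2 :=
        CharP.ringChar_of_prime_eq_zero Nat.prime_two (by exact_mod_cast h0)
      have heven := FiniteField.even_card_of_char_two hchar
      rw [Nat.card_eq_fintype_card, Nat.odd_iff] at hodd
      omega
  · exact ⟨hmap h,
      ClassicalForm.sameType_eigenspaceForm hβ hnd h2 hX₁ h (one_mul 1),
      ClassicalForm.sameType_eigenspaceForm hβ hnd h2 hX₁ h (by ring)⟩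
  · rintro ⟨hconj, ht₁, ht₂⟩
    obtain ⟨φ, hφ⟩ := ClassicalForm.exists_intertwining_of_isConj hconj
    have hsymm := fun (X : V ≃ₗ[F] V) (a : F) => (hβ.eigenspaceForm X a).isSymmPairing
    have hiso : ∀ a : F, a * a = 1 →
        ClassicalForm.SameType (ClassicalForm.eigenspaceForm β (X₁ : V ≃ₗ[F] V) a)
          (ClassicalForm.eigenspaceForm β (X₂ : V ≃ₗ[F] V) a) →
        ClassicalForm.Isometric F
          (fun u v => ClassicalForm.eigenspaceForm β (X₁ : V ≃ₗ[F] V) a u v)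
          (fun u v => ClassicalForm.eigenspaceForm β (X₂ : V ≃ₗ[F] V) a u v) := fun a ha ht =>
      ht.isometric (hsymm _ a) (hsymm _ a)
        (ClassicalForm.nondegRight_eigenspaceForm hnd h2 X₁ hX₁ ha hβ.1)
        (ClassicalForm.nondegRight_eigenspaceForm hnd h2 X₂ hX₂ ha hβ.1) h2
        (ClassicalForm.eigenspaceEquiv hφ a).finrank_eq
    obtain ⟨ψ, hψ, hψiso⟩ := hβ.exists_isometry_of_intertwining hβ h2 hnd hnd X₁ X₂ hX₁ hX₂ φ hφ
      (by
        rintro a (rfl | rfl)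
        · exact hiso 1 (one_mul 1) ht₁
        · exact hiso (-1) (by ring) ht₂)
    exact ClassicalForm.isConj_of_intertwining ψ hψ hψiso
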